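/- **Setting.** Let $a<\alpha<b$, $\Omega=(a,b)$, $\Omega^-=(a,\alpha)$, $\Omega^+=(\alpha,b)$, and let $\beta=\beta^->0$ on $\Omega^-$, $\beta=\beta^+>0$ on $\Omega^+$ be piecewise constant. Put $\beta_{\max}=\max\{\beta^-,\beta^+\}$, $\beta_{\min}=\min\{\beta^-,\beta^+\}$, $\rho=\beta_{\max}/\beta_{\min}$, and let $[\![v(\alpha)]\!]=v(\alpha^+)-v(\alpha^-)$. Consider $$-(\beta u')'=f \ \text{ in } \Omega^-\cup\Omega^+,\qquad u(a)=u(b)=0,\qquad [\![u(\alpha)]\!]=[\![\beta u'(\alpha)]\!]=0 .$$ For $m\ge1$ let $\tilde W^{m,\infty}_\beta(\Omega)$ be the set of $v\in C([a,b])$ with $v|_{\Omega^\pm}\in W^{m,\infty}(\Omega^\pm)$, $v(a)=v(b)=0$ and $[\![\beta v^{(j)}(\alpha)]\!]=0$ for $1\le j\le m-1$, and let $|v|_{m,\infty}=\max\{\|v^{(m)}\|_{L^\infty(\Omega^-)},\|v^{(m)}\|_{L^\infty(\Omega^+)}\}$. *Mesh.* Let $a=x_0<x_1<\dots<x_N=b$,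 $\tau_i=(x_{i-1},x_i)$, $h_i=x_i-x_{i-1}$, $h=\max_i h_i$, and let $k$ be an index with $x_{k-1}\le\alpha\le x_k$; $\tau_k$ is the interface element. Let $\xi_i(x)=(2x-x_{i-1}-x_i)/h_i$ map $\tau_i$ onto $(-1,1)$. *Polynomials.* $P_n$ are the Legendre polynomials on $[-1,1]$; the Lobatto polynomials are $\psi_0(\xi)=\frac{1-\xi}2$, $\psi_1(\xi)=\frac{1+\xi}2$, $\psi_n(\xi)=\int_{-1}^\xi P_{n-1}$ for $n\ge2$. Put $\hat\alpha=\xi_k(\alpha)$ and let $\hat\beta=\beta^-$ on $(-1,\hat\alpha)$, $\hat\beta=\beta^+$ on $(\hat\alpha,1)$. The generalized Legendre polynomials $L_n$ are the monic polynomials of degree $n$ that are orthogonal on $[-1,1]$ with respect to the weight $1/\hat\beta$. The generalized Lobatto polynomials are $\phi_n(\xi)=\int_{-1}^\xi \hat\beta^{-1}L_{n-1}$ for $n\ge2$, and $\phi_0,\phi_1$ are the continuous functions on $[-1,1]$, affine on each side of $\hat\alpha$, with $[\![\hat\beta\phi_n'(\hat\alpha)]\!]=0$ (void if $\hat\alpha=\pm1$),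 $\phi_0(-1)=\phi_1(1)=1$ and $\phi_0(1)=\phi_1(-1)=0$. Write $\psi_{i,n}=\psi_n\circ\xi_i$, $P_{i,n}=P_n\circ\xi_i$, $\phi_{k,n}=\phi_n\circ\xi_k$, $L_{k,n}=L_n\circ\xi_k$. *Method.* $S_p$ is the space of $v\in H^1_0(\Omega)$ with $v|_{\tau_i}\in\operatorname{span}\{\psi_{i,n}:0\le n\le p\}$ for $i\ne k$ and $v|_{\tau_k}\in\operatorname{span}\{\phi_{k,n}:0\le n\le p\}$. The immersed finite element (IFE) solution is $u_h\in S_p$ with $\int_a^b\beta u_h'v_h'\,dx=\int_a^b fv_h\,dx$ for all $v_h\in S_p$. The interpolant $\mathcal I_hu$ equals $\sum_{n=0}^p u_{i,n}\psi_{i,n}$ on $\tau_i$ for $i\ne k$ and $\sum_{n=0}^p u_{k,n}\phi_{k,n}$ on $\tau_k$, where $u_{i,0}=u(x_{i-1})$ and $u_{i,1}=u(x_i)$ for every $i$ and, for $n\ge2$, $$u_{i,n}=\frac{\int_{\tau_i}u'\psi_{i,n}'\,dx}{\int_{\tau_i}(\psi_{i,n}')^2\,dx}\ (i\neq k),\qquad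 u_{k,n}=\frac{\int_{\tau_k}\beta u'\phi_{k,n}'\,dx}{\int_{\tau_k}\beta(\phi_{k,n}')^2\,dx}.$$ **Theorem 4.1 (superconvergence for diffusion interface problems).** Let $p\ge2$. There are a constant $C$ depending only on $p$ and a constant $K$ depending only on $p$ and $\rho$ such that in the above setting, if $u\in\tilde W^{p+2,\infty}_\beta(\Omega)$ is the exact solution and $u_h$ is the IFE solution, the following hold. 1. $u_h=\mathcal I_hu$ on $[a,b]$, and $u_h$ is exact at the mesh points: $(u-u_h)(x_i)=0$ for $i=0,\dots,N$. 2. On every noninterface element $\tau_i$, $i\ne k$: $|(u-u_h)(l)|\le C h^{p+2}|u|_{p+2,\infty}$ at every root $l\in\overline{\tau_i}$ of $\psi_{i,p+1}$, and $|(u'-u_h')(g)|\le C h^{p+1}|u|_{p+2,\infty}$ at every root $g\in\overline{\tau_i}$ of $P_{i,p}$. 3. On the interface element $\tau_k$: $|(u-u_h)(l)|\le K h^{p+2}|u|_{p+2,\infty}$ at every root $l\in\overline{\tau_k}$ of $\phi_{k,p+1}$, and $|(\beta u'-\beta u_h')(g)|\le K\,\beta_{\max}\,h^{p+1}|u|_{p+2,\infty}$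 at every root $g\in\overline{\tau_k}$ of $L_{k,p}$ (if $g=\alpha$, the fluxes are taken as their common one-sided limits). -/

import Mathlib

open MeasureTheory Filter Topology Set Polynomial
open scoped ENNReal ContDiff

noncomputable section

namespace IFE

/-! ### Sobolev spaces on an interval, through weak derivatives -/

/-- `g` is the `n`-th weak derivative of `v` on the open set `I`. -/
def HasWeakDeriv (n : ℕ) (I : Set ℝ) (v g : ℝ → ℝ) : Prop :=
  LocallyIntegrableOn v I ∧ LocallyIntegrableOn g I ∧
    ∀ η : ℝ → ℝ, ContDiff ℝ ∞ η → HasCompactSupport η → tsupport η ⊆ I →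
      ∫ x in I, v x * iteratedDeriv n η x = (-1) ^ n * ∫ x in I, g x * η x

/-- The `n`-th weak derivative of `v` on `I` (unique up to a null set; `0` if there is none). -/
def weakDeriv (n : ℕ) (I : Set ℝ) (v : ℝ → ℝ) : ℝ → ℝ :=
  open Classical in if h : ∃ g, HasWeakDeriv n I v g then h.choose else 0

/-- `v ∈ W^{m,q}(I)`: all weak derivatives of order at most `m` exist and lie in `L^q(I)`. -/
def MemW (m : ℕ) (q : ℝ≥0∞) (I : Set ℝ) (v : ℝ → ℝ) : Prop :=
  ∀ j ≤ m, ∃ g, HasWeakDeriv j I v g ∧ MemLp g q (volume.restrict I)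

/-- The seminorm `|v|_{m,∞,I}`, the essential supremum of the `m`-th weak derivative. -/
def seminormInf (m : ℕ) (I : Set ℝ) (v : ℝ → ℝ) : ℝ :=
  (eLpNorm (weakDeriv m I v) ∞ (volume.restrict I)).toReal

/-- The seminorm `|v|_{m,∞}` on `Ω = (a,b)`, taken piecewise on `(a,α)` and `(α,b)`. -/
def brokenSeminormInf (m : ℕ) (a α b : ℝ) (v : ℝ → ℝ) : ℝ :=
  max (seminormInf m (Ioo a α) v) (seminormInf m (Ioo α b) v)

/-- `v ∈ H¹₀(a,b)`, represented by its continuous representative on `[a,b]`. -/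
def MemH10 (a b : ℝ) (v : ℝ → ℝ) : Prop :=
  MemW 1 2 (Ioo a b) v ∧ ContinuousOn v (Icc a b) ∧ v a = 0 ∧ v b = 0

/-! ### The interface problem -/

/-- The piecewise constant coefficient: `βm` left of `α`, `βp` right of it
(the value at the single point `α` plays no role). -/
def coeff (βm βp α x : ℝ) : ℝ := if x < α then βm else βp

/-- `⟦g(α)⟧ = 0`: the one-sided limits of `g` at `α` exist and agree. -/
def NoJump (g : ℝ → ℝ) (α : ℝ) : Prop :=
  ∃ l, Tendsto g (𝓝[<] α) (𝓝 l) ∧ Tendsto g (𝓝[>] α) (𝓝 l)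

/-- The space `W̃_β^{m,q}(Ω)`, `Ω = (a,b)`, with interface `α`. A continuous function that is
piecewise `W^{m,q}` is piecewise `C^{m-1}` with one-sided limits of its derivatives of order
at most `m - 1` at `α`, so these are the derivatives for which a jump is defined. -/
structure MemWTilde (m : ℕ) (q : ℝ≥0∞) (βm βp a α b : ℝ) (v : ℝ → ℝ) : Prop where
  continuousOn : ContinuousOn v (Icc a b)
  left : MemW m q (Ioo a α) v
  right : MemW m q (Ioo α b) v
  zero_left : v a = 0
  zero_right : v b = 0
  jump : ∀ j, 1 ≤ j → j < m → NoJump (fun x => coeff βm βp α x * iteratedDeriv j v x) α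

/-- `u` solves `-(β u')' = f` on `(a,α) ∪ (α,b)` (almost everywhere), `u(a) = u(b) = 0`,
`⟦u(α)⟧ = 0`, `⟦β u'(α)⟧ = 0`. -/
structure IsExactSolution (βm βp a α b : ℝ) (f u : ℝ → ℝ) : Prop where
  eqn : ∀ᵐ x, x ∈ Ioo a α ∪ Ioo α b →
    -deriv (fun y => coeff βm βp α y * deriv u y) x = f x
  zero_left : u a = 0
  zero_right : u b = 0
  jump_val : NoJump u α
  jump_flux : NoJump (fun x => coeff βm βp α x * deriv u x) α

/-- `F` is the value at `x` of the flux `β v'`: the ordinary value for `x ≠ α`, and the value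
of its continuous extension for `x = α`. -/
def IsFluxValue (βm βp α : ℝ) (v : ℝ → ℝ) (x F : ℝ) : Prop :=
  (∀ᶠ y in 𝓝[≠] x, DifferentiableAt ℝ v y) ∧
    Tendsto (fun y => coeff βm βp α y * deriv v y) (𝓝[≠] x) (𝓝 F) ∧
    (x ≠ α → DifferentiableAt ℝ v x ∧ coeff βm βp α x * deriv v x = F)

/-! ### Standard and generalized orthogonal polynomials on `[-1,1]` -/

/-- The Legendre polynomial `P_n`, by Rodrigues' formula. -/
def legendre (n : ℕ) : ℝ[X] :=
  C (1 / (2 ^ n * (n.factorial : ℝ))) * derivative^[n] ((X ^ 2 - 1) ^ n)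

/-- The Lobatto polynomials `ψ_n`. -/
def lobatto : ℕ → ℝ → ℝ
  | 0, ξ => (1 - ξ) / 2
  | 1, ξ => (1 + ξ) / 2
  | n + 2, ξ => ∫ t in (-1 : ℝ)..ξ, (legendre (n + 1)).eval t

/-- The weighted inner product `(P,Q)_w` on `[-1,1]`, `w = 1/β̂`, with reference interface
point `s`. -/
def wInner (βm βp s : ℝ) (P Q : ℝ[X]) : ℝ :=
  ∫ ξ in (-1 : ℝ)..1, (coeff βm βp s ξ)⁻¹ * (P.eval ξ * Q.eval ξ)

/-- The monic generalized Legendre polynomials `L_n`, by the three-term recurrence. -/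
def genLegendre (βm βp s : ℝ) : ℕ → ℝ[X]
  | 0 => 1
  | 1 => X - C (wInner βm βp s X 1 / wInner βm βp s 1 1)
  | n + 2 =>
      (X - C (wInner βm βp s (X * genLegendre βm βp s (n + 1)) (genLegendre βm βp s (n + 1)) /
          wInner βm βp s (genLegendre βm βp s (n + 1)) (genLegendre βm βp s (n + 1)))) *
        genLegendre βm βp s (n + 1) -
      C (wInner βm βp s (genLegendre βm βp s (n + 1)) (genLegendre βm βp s (n + 1)) /
          wInner βm βp s (genLegendre βm βp s n) (genLegendre βm βp s n)) *
        genLegendre βm βp s n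

/-- The generalized Lobatto polynomials `φ_n` (piecewise polynomials). -/
def genLobatto (βm βp s : ℝ) : ℕ → ℝ → ℝ
  | 0, ξ =>
      if ξ < s then ((1 - s) * βm + (s - ξ) * βp) / ((1 - s) * βm + (1 + s) * βp)
      else ((1 - ξ) * βm) / ((1 - s) * βm + (1 + s) * βp)
  | 1, ξ =>
      if ξ < s then ((1 + ξ) * βp) / ((1 - s) * βm + (1 + s) * βp)
      else ((ξ - s) * βm + (1 + s) * βp) / ((1 - s) * βm + (1 + s) * βp)
  | n + 2, ξ => ∫ t in (-1 : ℝ)..ξ, (coeff βm βp s t)⁻¹ * (genLegendre βm βp s (n + 1)).eval t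

/-! ### Meshes and the immersed finite element space -/

/-- A partition `a = x_0 < x_1 < ⋯ < x_N = b`. -/
structure Mesh (a b : ℝ) (N : ℕ) where
  node : Fin (N + 1) → ℝ
  strictMono : StrictMono node
  node_zero : node 0 = a
  node_last : node (Fin.last N) = b

namespace Mesh

variable {a b : ℝ} {N : ℕ}

/-- Left end point of an element. -/
def lft (T : Mesh a b N) (i : Fin N) : ℝ := T.node i.castSucc

/-- Right end point of an element. -/
def rgt (T : Mesh a b N) (i : Fin N) : ℝ := T.node i.succ

/-- The mesh size, the maximal length of an element. -/
def size (T : Mesh a b N) : ℝ := ⨆ i, (T.rgt i - T.lft i)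

/-- The affine map of element `i` onto the reference interval `[-1,1]`. -/
def toRef (T : Mesh a b N) (i : Fin N) (x : ℝ) : ℝ :=
  (2 * x - T.lft i - T.rgt i) / (T.rgt i - T.lft i)

/-- `ψ_{i,n}`. -/
def lobatto (T : Mesh a b N) (i : Fin N) (n : ℕ) (x : ℝ) : ℝ :=
  IFE.lobatto n (T.toRef i x)

/-- `P_{i,n}`. -/
def legendre (T : Mesh a b N) (i : Fin N) (n : ℕ) (x : ℝ) : ℝ :=
  (IFE.legendre n).eval (T.toRef i x)

/-- `φ_{k,n}`, for the interface point `α` in element `k`. -/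
def genLobatto (T : Mesh a b N) (βm βp α : ℝ) (k : Fin N) (n : ℕ) (x : ℝ) : ℝ :=
  IFE.genLobatto βm βp (T.toRef k α) n (T.toRef k x)

/-- `L_{k,n}`, for the interface point `α` in element `k`. -/
def genLegendre (T : Mesh a b N) (βm βp α : ℝ) (k : Fin N) (n : ℕ) (x : ℝ) : ℝ :=
  (IFE.genLegendre βm βp (T.toRef k α) n).eval (T.toRef k x)

/-- The immersed finite element space `S_p`, with interface element `k`. -/
structure MemSpace (T : Mesh a b N) (βm βp α : ℝ) (k : Fin N) (p : ℕ) (v : ℝ → ℝ) : Prop where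
  memH10 : MemH10 a b v
  nonInterface : ∀ i, i ≠ k →
    ∃ w ∈ Submodule.span ℝ {g : ℝ → ℝ | ∃ n ≤ p, g = T.lobatto i n},
      EqOn v w (Ioo (T.lft i) (T.rgt i))
  interface :
    ∃ w ∈ Submodule.span ℝ {g : ℝ → ℝ | ∃ n ≤ p, g = T.genLobatto βm βp α k n},
      EqOn v w (Ioo (T.lft k) (T.rgt k))

/-- `uh ∈ S_p` and `(β uh', vh') = (f, vh)` for all `vh ∈ S_p`. Members of `S_p` are
piecewise smooth, so that `deriv` is their weak derivative almost everywhere. -/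
def IsIFESolution (T : Mesh a b N) (βm βp α : ℝ) (k : Fin N) (p : ℕ) (f uh : ℝ → ℝ) : Prop :=
  T.MemSpace βm βp α k p uh ∧
    ∀ vh, T.MemSpace βm βp α k p vh →
      ∫ x in a..b, coeff βm βp α x * deriv uh x * deriv vh x = ∫ x in a..b, f x * vh x

/-- The coefficients `u_{i,n}` of the Lobatto expansion on element `i`. -/
def lobattoCoeff (T : Mesh a b N) (i : Fin N) (u : ℝ → ℝ) : ℕ → ℝ
  | 0 => u (T.lft i)
  | 1 => u (T.rgt i)
  | n + 2 => (∫ x in T.lft i..T.rgt i, deriv u x * deriv (T.lobatto i (n + 2)) x) /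
      ∫ x in T.lft i..T.rgt i, deriv (T.lobatto i (n + 2)) x * deriv (T.lobatto i (n + 2)) x

/-- The coefficients `u_{k,n}` of the generalized Lobatto expansion on the interface
element `k`. -/
def genLobattoCoeff (T : Mesh a b N) (βm βp α : ℝ) (k : Fin N) (u : ℝ → ℝ) : ℕ → ℝ
  | 0 => u (T.lft k)
  | 1 => u (T.rgt k)
  | n + 2 =>
      (∫ x in T.lft k..T.rgt k,
          coeff βm βp α x * deriv u x * deriv (T.genLobatto βm βp α k (n + 2)) x) /
        ∫ x in T.lft k..T.rgt k, coeff βm βp α x *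
          deriv (T.genLobatto βm βp α k (n + 2)) x * deriv (T.genLobatto βm βp α k (n + 2)) x

/-- The interpolant `I_h u` on element `i`, where `k` is the interface element. -/
def interp (T : Mesh a b N) (βm βp α : ℝ) (k : Fin N) (p : ℕ) (u : ℝ → ℝ) (i : Fin N)
    (x : ℝ) : ℝ :=
  if i = k then
    ∑ n ∈ Finset.range (p + 1), T.genLobattoCoeff βm βp α k u n * T.genLobatto βm βp α k n x
  else ∑ n ∈ Finset.range (p + 1), T.lobattoCoeff i u n * T.lobatto i n x

end Mesh

end IFE

end

/-!
The proof works on each element in physical coordinates, with the flux `G = β u'` in place of `u`.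

*Smoothness of the flux.* Functions in `W^{p+2,∞}` of an interval are of class `C^{p+1}` with
Lipschitz derivative of order `p + 1` (`MemW.exists_contDiff`, by the lemma of du Bois-Reymond). The
jump conditions `⟦β u^{(j)}(α)⟧ = 0`, `1 ≤ j ≤ p + 1`, say precisely that the Taylor polynomials of
degree `p` of `G` from the left and from the right of `α` coincide. So, although `u` has a kink, `G`
is within `β_max |u|_{p+2,∞} h^{p+1}` of one polynomial of degree `p` on the whole interface element
(`IsSmoothRep.exists_taylor`).

*Projection.* On the interface element, the flux `q` of the interpolant `I_h u` is the orthogonal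
projection of `G` onto polynomials of degree less than `p`, with weight `1/β`: orthogonality to
constants is interpolation at the end points, orthogonality to `L_n` is the formula for the
coefficient of `φ_{n+1}` (`IsLobattoFamily.exists_isLobattoApprox`). Noninterface elements are the
same with weight `1`, the Lobatto polynomials being the case of constant weight.

*Superconvergence.* Up to a multiple of `L_p`, the flux error `G - q` is the error of the projection
onto degree at most `p`. By an inverse inequality that projection is stable in the maximum norm, with
constant `1 + √(κ ρ)`, so `G - q - c L_p` is of order `h^{p+1}`
(`exists_abs_sub_le_of_ortho`). This bounds the flux error at the roots of `L_p`. Integrating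
`β⁻¹ (G - q)` from the left end point, the multiple of `L_p` contributes a multiple of `φ_{p+1}`,
which bounds the error at the roots of `φ_{p+1}`. Orthogonal polynomials have their roots in the open
interval (`IsOrthoPoly.mem_Ioo_of_eval_eq_zero`), so these bounds concern genuine derivatives.

*The discrete solution.* The projection property gives Galerkin orthogonality of `u - I_h u` on each
element, and `I_h u` is continuous since it interpolates `u` at the nodes. Hence `I_h u - u_h` is an
admissible test function of zero energy, and `u_h = I_h u` (`Mesh.IsIFESolution.eqOn`).
-/

noncomputable section

namespace IFE

/-! ### Weighted inner products and orthogonal polynomials -/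

/-- A measurable weight with values between two positive constants. -/
structure IsWeight (w : ℝ → ℝ) (lo hi : ℝ) : Prop where
  measurable : Measurable w
  lo_pos : 0 < lo
  lo_le : ∀ x, lo ≤ w x
  le_hi : ∀ x, w x ≤ hi

/-- The weighted inner product of `f` and `g` in `L²(x0, x1)` with weight `w`. -/
def ip (w : ℝ → ℝ) (x0 x1 : ℝ) (f g : ℝ → ℝ) : ℝ := ∫ x in x0..x1, w x * (f x * g x)

section Weight

variable {w : ℝ → ℝ} {lo hi x0 x1 : ℝ}

theorem IsWeight.pos (hw : IsWeight w lo hi) (x : ℝ) : 0 < w x :=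
  hw.lo_pos.trans_le (hw.lo_le x)

theorem IsWeight.hi_pos (hw : IsWeight w lo hi) : 0 < hi := (hw.pos 0).trans_le (hw.le_hi 0)

theorem isWeight_one : IsWeight (fun _ => 1) 1 1 :=
  ⟨measurable_const, one_pos, fun _ => le_rfl, fun _ => le_rfl⟩

theorem IsWeight.intervalIntegrable (hw : IsWeight w lo hi) (a b : ℝ) :
    IntervalIntegrable w volume a b := by
  refine (intervalIntegrable_const (c := hi)).mono_fun hw.measurable.aestronglyMeasurable ?_
  refine Eventually.of_forall fun x => ?_
  simp only [Real.norm_eq_abs]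
  rw [abs_of_pos (hw.pos x), abs_of_pos hw.hi_pos]
  exact hw.le_hi x

theorem IsWeight.intervalIntegrable_mul (hw : IsWeight w lo hi) {g : ℝ → ℝ} {a b : ℝ}
    (hg : ContinuousOn g (uIcc a b)) :
    IntervalIntegrable (fun x => w x * g x) volume a b :=
  (hw.intervalIntegrable a b).mul_continuousOn hg

theorem IsWeight.integrable (hw : IsWeight w lo hi) {g : ℝ → ℝ} (hg : Continuous g) (a b : ℝ) :
    IntervalIntegrable (fun x => w x * g x) volume a b :=
  hw.intervalIntegrable_mul hg.continuousOn

theorem ip_comm (w : ℝ → ℝ) (x0 x1 : ℝ) (f g : ℝ → ℝ) : ip w x0 x1 f g = ip w x0 x1 g f := by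
  simp only [ip, mul_comm]

theorem ip_add_left (hw : IsWeight w lo hi) {f g h : ℝ → ℝ} (hf : Continuous f)
    (hg : Continuous g) (hh : Continuous h) :
    ip w x0 x1 (fun x => f x + g x) h = ip w x0 x1 f h + ip w x0 x1 g h := by
  unfold ip
  rw [← intervalIntegral.integral_add (hw.integrable (g := fun x => f x * h x) (by fun_prop) _ _)
    (hw.integrable (g := fun x => g x * h x) (by fun_prop) _ _)]
  congr 1; ext x; ring

theorem ip_const_mul_left (w : ℝ → ℝ) (x0 x1 : ℝ) (c : ℝ) (f h : ℝ → ℝ) :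
    ip w x0 x1 (fun x => c * f x) h = c * ip w x0 x1 f h := by
  unfold ip
  rw [← intervalIntegral.integral_const_mul]
  congr 1; ext x; ring

theorem ip_const_mul_right (w : ℝ → ℝ) (x0 x1 : ℝ) (c : ℝ) (f h : ℝ → ℝ) :
    ip w x0 x1 h (fun x => c * f x) = c * ip w x0 x1 h f := by
  rw [ip_comm, ip_const_mul_left, ip_comm]

theorem ip_sub_left (hw : IsWeight w lo hi) {f g h : ℝ → ℝ} (hf : Continuous f)
    (hg : Continuous g) (hh : Continuous h) :
    ip w x0 x1 (fun x => f x - g x) h = ip w x0 x1 f h - ip w x0 x1 g h := by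
  unfold ip
  rw [← intervalIntegral.integral_sub (hw.integrable (g := fun x => f x * h x) (by fun_prop) _ _)
    (hw.integrable (g := fun x => g x * h x) (by fun_prop) _ _)]
  congr 1; ext x; ring

theorem ip_add_right (hw : IsWeight w lo hi) {f g h : ℝ → ℝ} (hf : Continuous f)
    (hg : Continuous g) (hh : Continuous h) :
    ip w x0 x1 h (fun x => f x + g x) = ip w x0 x1 h f + ip w x0 x1 h g := by
  rw [ip_comm, ip_add_left hw hf hg hh, ip_comm, ip_comm w x0 x1 g]

theorem ip_sub_right (hw : IsWeight w lo hi) {f g h : ℝ → ℝ} (hf : Continuous f)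
    (hg : Continuous g) (hh : Continuous h) :
    ip w x0 x1 h (fun x => f x - g x) = ip w x0 x1 h f - ip w x0 x1 h g := by
  rw [ip_comm, ip_sub_left hw hf hg hh, ip_comm, ip_comm w x0 x1 g]

theorem IsWeight.integral_pos (hw : IsWeight w lo hi) (h01 : x0 < x1) {f : ℝ → ℝ}
    (hf : Continuous f) (h0 : ∀ x ∈ Icc x0 x1, 0 ≤ f x) {c : ℝ} (hc : c ∈ Icc x0 x1)
    (hfc : 0 < f c) : 0 < ∫ x in x0..x1, w x * f x := by
  have h1 : 0 < ∫ x in x0..x1, f x :=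
    intervalIntegral.integral_pos h01 hf.continuousOn
      (fun x hx => h0 x (Ioc_subset_Icc_self hx)) ⟨c, hc, hfc⟩
  calc 0 < lo * ∫ x in x0..x1, f x := mul_pos hw.lo_pos h1
    _ = ∫ x in x0..x1, lo * f x := (intervalIntegral.integral_const_mul _ _).symm
    _ ≤ ∫ x in x0..x1, w x * f x := by
      refine intervalIntegral.integral_mono_on h01.le
        ((continuous_const.mul hf).intervalIntegrable _ _) (hw.integrable hf _ _) fun x hx => ?_
      exact mul_le_mul_of_nonneg_right (hw.lo_le x) (h0 x hx)

/-- A nonzero polynomial has a nonroot in every nondegenerate open interval. -/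
theorem exists_eval_ne_zero (h01 : x0 < x1) {P : ℝ[X]} (hP : P ≠ 0) :
    ∃ c ∈ Ioo x0 x1, P.eval c ≠ 0 := by
  by_contra! h
  exact hP (P.eq_zero_of_infinite_isRoot ((Ioo_infinite h01).mono fun x hx => h x hx))

theorem ip_self_pos (hw : IsWeight w lo hi) (h01 : x0 < x1) {P : ℝ[X]} (hP : P ≠ 0) :
    0 < ip w x0 x1 (fun x => P.eval x) (fun x => P.eval x) := by
  obtain ⟨c, hc, hPc⟩ := exists_eval_ne_zero h01 hP
  exact hw.integral_pos h01 (by fun_prop) (fun x _ => mul_self_nonneg _)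
    (Ioo_subset_Icc_self hc) (mul_self_pos.2 hPc)

/-- `P` is a polynomial of exact degree `n`, orthogonal to all polynomials of smaller degree
in the weighted `L²` inner product of `(x0, x1)`. -/
structure IsOrthoPoly (w : ℝ → ℝ) (x0 x1 : ℝ) (n : ℕ) (P : ℝ[X]) : Prop where
  degree_eq : P.degree = n
  ortho : ∀ r : ℝ[X], r.degree < n → ip w x0 x1 (fun x => P.eval x) (fun x => r.eval x) = 0

theorem IsOrthoPoly.ne_zero {n : ℕ} {P : ℝ[X]} (hP : IsOrthoPoly w x0 x1 n P) : P ≠ 0 := by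
  rintro rfl
  simpa using hP.degree_eq

/-- A polynomial of degree at most `n` is the sum of a multiple of a given polynomial of exact
degree `n` and a polynomial of smaller degree. -/
theorem exists_eq_C_mul_add {n : ℕ} {P r : ℝ[X]} (hP : P.degree = n)
    (hr : r.degree < ((n + 1 : ℕ) : WithBot ℕ)) :
    ∃ (c : ℝ) (s : ℝ[X]), s.degree < n ∧ r = C c * P + s := by
  have hP0 : P.leadingCoeff ≠ 0 := by
    rw [Ne, leadingCoeff_eq_zero]; rintro rfl; simp at hP
  have hnd : P.natDegree = n := natDegree_eq_of_degree_eq_some hP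
  refine ⟨r.coeff n / P.leadingCoeff, r - C (r.coeff n / P.leadingCoeff) * P, ?_, by ring⟩
  rw [degree_lt_iff_coeff_zero]
  intro m hm
  rcases hm.eq_or_lt with rfl | hm
  · rw [coeff_sub, coeff_C_mul, leadingCoeff, hnd]
    rw [leadingCoeff, hnd] at hP0
    field_simp; ring
  · rw [coeff_sub, coeff_C_mul, coeff_eq_zero_of_degree_lt (p := P) (by rw [hP]; exact_mod_cast hm),
      coeff_eq_zero_of_degree_lt (hr.trans_le (by exact_mod_cast hm)), mul_zero, sub_zero]

/-- Polynomials `Q 0, …, Q (n - 1)` of exact degrees `0, …, n - 1` span all polynomials of degree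
less than `n`. -/
theorem mem_of_degree_lt {Q : ℕ → ℝ[X]} {S : Submodule ℝ ℝ[X]} {n : ℕ}
    (hQ : ∀ j < n, (Q j).degree = j) (hS : ∀ j < n, Q j ∈ S) {r : ℝ[X]} (hr : r.degree < n) :
    r ∈ S := by
  induction n generalizing r with
  | zero =>
    have : r = 0 := by
      rw [← degree_eq_bot]; exact Nat.WithBot.lt_zero_iff.1 (by simpa using hr)
    rw [this]; exact S.zero_mem
  | succ n ih =>
    obtain ⟨c, s, hs, rfl⟩ := exists_eq_C_mul_add (hQ n n.lt_succ_self) hr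
    refine S.add_mem ?_ (ih (fun j hj => hQ j (hj.trans n.lt_succ_self))
      (fun j hj => hS j (hj.trans n.lt_succ_self)) hs)
    rw [← smul_eq_C_mul]
    exact S.smul_mem _ (hS n n.lt_succ_self)

/-- Orthogonal polynomials have no roots outside the open interval: dividing by the linear factor
of such a root gives a polynomial of smaller degree that is not orthogonal to `P`. -/
theorem IsOrthoPoly.mem_Ioo_of_eval_eq_zero (hw : IsWeight w lo hi) (h01 : x0 < x1) {n : ℕ}
    {P : ℝ[X]} (hP : IsOrthoPoly w x0 x1 n P) {c : ℝ} (hc : P.eval c = 0) : c ∈ Ioo x0 x1 := by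
  by_contra hcn
  obtain ⟨r, hr⟩ := dvd_iff_isRoot.2 hc
  have hr0 : r ≠ 0 := by rintro rfl; exact hP.ne_zero (by simpa using hr)
  have hdeg : r.degree < n := by
    rw [← hP.degree_eq, hr, degree_mul, degree_X_sub_C, degree_eq_natDegree hr0]
    norm_cast; omega
  have h0 := hP.ortho r hdeg
  obtain ⟨d, hd, hrd⟩ := exists_eval_ne_zero h01 hr0
  have hne : d - c ≠ 0 := fun h => hcn (by rwa [← sub_eq_zero.1 h])
  simp only [ip, hr, eval_mul, eval_sub, eval_X, eval_C] at h0
  rcases le_or_gt c x0 with hcx | hcx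
  · refine (hw.integral_pos h01 (f := fun x => (x - c) * r.eval x * r.eval x) (by fun_prop)
      (fun x hx => ?_) (Ioo_subset_Icc_self hd) ?_).ne' h0
    · have := mul_self_nonneg (r.eval x)
      rw [mul_assoc]; exact mul_nonneg (by linarith [hx.1]) this
    · have := mul_self_pos.2 hrd
      rw [mul_assoc]; exact mul_pos (by linarith [hd.1]) this
  · have hcx1 : x1 ≤ c := by
      by_contra h; exact hcn ⟨hcx, not_le.1 h⟩
    have h0' : ∫ x in x0..x1, w x * ((c - x) * r.eval x * r.eval x) = 0 := by
      rw [← neg_eq_zero, ← intervalIntegral.integral_neg, ← h0]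
      congr 1; ext x; ring
    refine (hw.integral_pos h01 (f := fun x => (c - x) * r.eval x * r.eval x) (by fun_prop)
      (fun x hx => ?_) (Ioo_subset_Icc_self hd) ?_).ne' h0'
    · have := mul_self_nonneg (r.eval x)
      rw [mul_assoc]; exact mul_nonneg (by linarith [hx.2]) this
    · have := mul_self_pos.2 hrd
      rw [mul_assoc]; exact mul_pos (by linarith [hd.2]) this

/-- Transport of an orthogonal polynomial from `[-1, 1]` to `[x0, x1]` by an affine map. -/
theorem IsOrthoPoly.comp_affine {n : ℕ} {P : ℝ[X]} (h01 : x0 < x1)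
    (hP : IsOrthoPoly w (-1) 1 n P) {v : ℝ → ℝ}
    (hv : ∀ x, v x = w ((2 * x - x0 - x1) / (x1 - x0))) :
    IsOrthoPoly v x0 x1 n (P.comp (C (2 / (x1 - x0)) * X + C (-(x0 + x1) / (x1 - x0)))) := by
  have hh : x1 - x0 ≠ 0 := (sub_pos.2 h01).ne'
  have h2 : (2 / (x1 - x0)) ≠ 0 := div_ne_zero two_ne_zero hh
  have hA : (C (2 / (x1 - x0)) * X + C (-(x0 + x1) / (x1 - x0)) : ℝ[X]).natDegree = 1 :=
    natDegree_linear h2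
  refine ⟨?_, fun r hr => ?_⟩
  · have hne : P.comp (C (2 / (x1 - x0)) * X + C (-(x0 + x1) / (x1 - x0))) ≠ 0 := by
      intro h
      rcases comp_eq_zero_iff.1 h with h | h
      · exact hP.ne_zero h
      · rw [h.2, natDegree_C] at hA; exact zero_ne_one hA
    rw [degree_eq_natDegree hne, natDegree_comp, hA, mul_one,
      natDegree_eq_of_degree_eq_some hP.degree_eq]
  · set B : ℝ[X] := C ((x1 - x0) / 2) * X + C ((x0 + x1) / 2) with hB
    have hB1 : B.natDegree = 1 := natDegree_linear (div_ne_zero hh two_ne_zero)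
    have hrB : (r.comp B).degree < n := by
      rcases eq_or_ne r 0 with rfl | hr0
      · simp
      · refine degree_le_natDegree.trans_lt ?_
        rw [natDegree_comp, hB1, mul_one, ← degree_eq_natDegree hr0]
        exact hr
    have h := hP.ortho _ hrB
    have key := intervalIntegral.integral_comp_mul_add (a := x0) (b := x1)
      (f := fun ξ => w ξ * (P.eval ξ * (r.comp B).eval ξ)) h2 (-(x0 + x1) / (x1 - x0))
    have e0 : 2 / (x1 - x0) * x0 + -(x0 + x1) / (x1 - x0) = -1 := by field_simp; ring
    have e1 : 2 / (x1 - x0) * x1 + -(x0 + x1) / (x1 - x0) = 1 := by field_simp; ring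
    rw [e0, e1] at key
    unfold ip at h ⊢
    rw [h, smul_zero] at key
    rw [← key]
    congr 1; ext x
    have e2 : 2 / (x1 - x0) * x + -(x0 + x1) / (x1 - x0) = (2 * x - x0 - x1) / (x1 - x0) := by
      field_simp; ring
    have e3 : (x1 - x0) / 2 * ((2 * x - x0 - x1) / (x1 - x0)) + (x0 + x1) / 2 = x := by
      field_simp; ring
    simp only [eval_comp, eval_add, eval_mul, eval_C, eval_X, hB, e2, e3, hv]

end Weight

/-! ### Orthogonality of the generalized Legendre and the Legendre polynomials -/

theorem isWeight_coeff_inv {βm βp : ℝ} (hm : 0 < βm) (hp : 0 < βp) (s : ℝ) :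
    IsWeight (fun x => (coeff βm βp s x)⁻¹) (max βm βp)⁻¹ (min βm βp)⁻¹ := by
  refine ⟨?_, by positivity, fun x => ?_, fun x => ?_⟩
  · exact (Measurable.ite measurableSet_Iio measurable_const measurable_const).inv
  · unfold coeff; split_ifs
    · exact inv_anti₀ hm (le_max_left _ _)
    · exact inv_anti₀ hp (le_max_right _ _)
  · unfold coeff; split_ifs
    · exact inv_anti₀ (lt_min hm hp) (min_le_left _ _)
    · exact inv_anti₀ (lt_min hm hp) (min_le_right _ _)

theorem degree_X_sub_C_mul_lt {r : ℝ[X]} {n : ℕ} (a : ℝ) (hr : r.degree < n) :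
    ((X - C a) * r).degree < ((n + 1 : ℕ) : WithBot ℕ) := by
  rcases eq_or_ne r 0 with rfl | hr0
  · simp
  · rw [degree_mul, degree_X_sub_C, degree_eq_natDegree hr0]
    rw [degree_eq_natDegree hr0] at hr
    norm_cast at hr ⊢; omega

/-- One step of the three-term recurrence preserves orthogonality. -/
theorem isOrthoPoly_three_term {w : ℝ → ℝ} {lo hi x0 x1 : ℝ} (hw : IsWeight w lo hi)
    (h01 : x0 < x1) {n : ℕ} {P Q : ℝ[X]} (hP : IsOrthoPoly w x0 x1 n P)
    (hQ : IsOrthoPoly w x0 x1 (n + 1) Q) (hPm : P.Monic) (hQm : Q.Monic) {c d : ℝ}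
    (hc : c = ip w x0 x1 (fun x => (X * Q).eval x) (fun x => Q.eval x) /
      ip w x0 x1 (fun x => Q.eval x) (fun x => Q.eval x))
    (hd : d = ip w x0 x1 (fun x => Q.eval x) (fun x => Q.eval x) /
      ip w x0 x1 (fun x => P.eval x) (fun x => P.eval x)) :
    IsOrthoPoly w x0 x1 (n + 2) ((X - C c) * Q - C d * P) ∧ ((X - C c) * Q - C d * P).Monic := by
  have hXQ : ((X - C c) * Q).Monic := (monic_X_sub_C c).mul hQm
  have hXQd : ((X - C c) * Q).degree = ((n + 2 : ℕ) : WithBot ℕ) := by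
    rw [degree_mul, degree_X_sub_C, hQ.degree_eq]; norm_cast; omega
  have hlt : (C d * P).degree < ((X - C c) * Q).degree := by
    rw [hXQd]
    rw [← smul_eq_C_mul]
    refine (degree_smul_le d P).trans_lt ?_
    rw [hP.degree_eq]; norm_cast; omega
  have hmon : ((X - C c) * Q - C d * P).Monic := hXQ.sub_of_left hlt
  refine ⟨⟨by rw [degree_sub_eq_left_of_degree_lt hlt, hXQd], fun r hr => ?_⟩, hmon⟩
  have hPpos := ip_self_pos hw h01 hP.ne_zero
  have hQpos := ip_self_pos hw h01 hQ.ne_zero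
  have expand : ∀ r : ℝ[X], ip w x0 x1 (fun x => ((X - C c) * Q - C d * P).eval x)
      (fun x => r.eval x) = ip w x0 x1 (fun x => Q.eval x) (fun x => ((X - C c) * r).eval x)
        - d * ip w x0 x1 (fun x => P.eval x) (fun x => r.eval x) := by
    intro r
    rw [← ip_const_mul_left]
    simp only [eval_sub, eval_mul, eval_C, eval_X]
    rw [ip_sub_left hw (by fun_prop) (by fun_prop) (by fun_prop)]
    congr 1
    unfold ip; congr 1; ext x; ring
  have hPQ : ip w x0 x1 (fun x => P.eval x) (fun x => Q.eval x) = 0 := by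
    rw [ip_comm]; exact hQ.ortho P (by rw [hP.degree_eq]; norm_cast; omega)
  -- orthogonality to `Q` is the choice of `c`, orthogonality to `P` the choice of `d`
  have h1 : ip w x0 x1 (fun x => ((X - C c) * Q - C d * P).eval x) (fun x => Q.eval x) = 0 := by
    rw [expand, hPQ, mul_zero, sub_zero]
    have : ip w x0 x1 (fun x => Q.eval x) (fun x => ((X - C c) * Q).eval x) =
        ip w x0 x1 (fun x => (X * Q).eval x) (fun x => Q.eval x) -
          c * ip w x0 x1 (fun x => Q.eval x) (fun x => Q.eval x) := by
      rw [← ip_const_mul_left, ← ip_sub_left hw (by fun_prop) (by fun_prop) (by fun_prop), ip_comm]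
      simp only [eval_mul, eval_sub, eval_X, eval_C]
      unfold ip; congr 1; ext x; ring
    rw [this, hc]; field_simp; ring
  have h2 : ip w x0 x1 (fun x => ((X - C c) * Q - C d * P).eval x) (fun x => P.eval x) = 0 := by
    rw [expand]
    have hdiff : ((X - C c) * P - Q).degree < ((n + 1 : ℕ) : WithBot ℕ) := by
      have hXP : ((X - C c) * P).degree = ((n + 1 : ℕ) : WithBot ℕ) := by
        rw [degree_mul, degree_X_sub_C, hP.degree_eq]; norm_cast; omega
      have := degree_sub_lt_left (hXP.trans hQ.degree_eq.symm) ((monic_X_sub_C c).mul hPm).ne_zero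
        (by rw [((monic_X_sub_C c).mul hPm).leadingCoeff, hQm.leadingCoeff])
      rwa [hXP] at this
    have h3 := hQ.ortho _ hdiff
    simp only [eval_sub _ Q] at h3
    rw [ip_sub_right hw (by fun_prop) (by fun_prop) (by fun_prop), sub_eq_zero] at h3
    rw [h3, hd]; field_simp; ring
  obtain ⟨c1, r1, hr1, rfl⟩ := exists_eq_C_mul_add hQ.degree_eq hr
  obtain ⟨c0, r0, hr0, rfl⟩ := exists_eq_C_mul_add hP.degree_eq hr1
  have h3 : ip w x0 x1 (fun x => ((X - C c) * Q - C d * P).eval x) (fun x => r0.eval x) = 0 := by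
    rw [expand, hP.ortho _ hr0, hQ.ortho _ (degree_X_sub_C_mul_lt c hr0)]; simp
  have : (fun x => (C c1 * Q + (C c0 * P + r0)).eval x) =
      fun x => c1 * Q.eval x + (c0 * P.eval x + r0.eval x) := by
    ext x; simp only [eval_add, eval_mul, eval_C]
  rw [this, ip_add_right hw (by fun_prop) (by fun_prop) (by fun_prop),
    ip_add_right hw (by fun_prop) (by fun_prop) (by fun_prop), ip_const_mul_right,
    ip_const_mul_right, h1, h2, h3]
  simp

theorem genLegendre_isOrthoPoly {βm βp : ℝ} (hm : 0 < βm) (hp : 0 < βp) (s : ℝ) (n : ℕ) :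
    IsOrthoPoly (fun x => (coeff βm βp s x)⁻¹) (-1) 1 n (genLegendre βm βp s n) ∧
      (genLegendre βm βp s n).Monic := by
  have hw := isWeight_coeff_inv hm hp s
  have h01 : (-1 : ℝ) < 1 := by norm_num
  induction n using Nat.strong_induction_on with
  | _ n ih =>
    match n with
    | 0 =>
      refine ⟨⟨by simp [genLegendre], fun r hr => ?_⟩, by simp [genLegendre]⟩
      have : r = 0 := by
        rw [← degree_eq_bot]; exact Nat.WithBot.lt_zero_iff.1 (by simpa using hr)
      simp [this, ip]
    | 1 =>
      refine ⟨⟨by simp [genLegendre], fun r hr => ?_⟩, by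
        rw [genLegendre]; exact monic_X_sub_C _⟩
      have h1 : r.natDegree = 0 := by
        rw [natDegree_eq_zero_iff_degree_le_zero]
        exact Nat.WithBot.lt_one_iff_le_zero.1 (by simpa using hr)
      rw [natDegree_eq_zero] at h1
      obtain ⟨e, rfl⟩ := h1
      have hpos := ip_self_pos hw h01 (one_ne_zero (α := ℝ[X]))
      have key : ip (fun x => (coeff βm βp s x)⁻¹) (-1) 1
          (fun x => (genLegendre βm βp s 1).eval x) (fun x => (1 : ℝ[X]).eval x) = 0 := by
        have : (fun x => (genLegendre βm βp s 1).eval x) =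
            fun x => (X : ℝ[X]).eval x - wInner βm βp s X 1 / wInner βm βp s 1 1 *
              (1 : ℝ[X]).eval x := by
          ext x; simp [genLegendre]
        rw [this, ip_sub_left hw (by fun_prop) (by fun_prop) (by fun_prop), ip_const_mul_left]
        change wInner βm βp s X 1 - wInner βm βp s X 1 / wInner βm βp s 1 1 *
          wInner βm βp s 1 1 = 0
        have : wInner βm βp s 1 1 ≠ 0 := hpos.ne'
        field_simp; ring
      have : (fun x => (C e : ℝ[X]).eval x) = fun x => e * (1 : ℝ[X]).eval x := by ext x; simp
      rw [this, ip_const_mul_right, key, mul_zero]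
    | n + 2 =>
      obtain ⟨hP, hPm⟩ := ih n (by omega)
      obtain ⟨hQ, hQm⟩ := ih (n + 1) (by omega)
      rw [genLegendre]
      exact isOrthoPoly_three_term hw h01 hP hQ hPm hQm rfl rfl

/-- Integration by parts for polynomials whose product vanishes at both end points. -/
theorem integral_derivative_mul {P Q : ℝ[X]} (h1 : (P * Q).eval 1 = 0)
    (h2 : (P * Q).eval (-1) = 0) :
    ∫ x in (-1 : ℝ)..1, (derivative P).eval x * Q.eval x =
      -∫ x in (-1 : ℝ)..1, P.eval x * (derivative Q).eval x := by
  have h := intervalIntegral.integral_eq_sub_of_hasDerivAt (a := -1) (b := 1)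
    (fun x _ => (P * Q).hasDerivAt x) (by apply Continuous.intervalIntegrable; fun_prop)
  rw [h1, h2, sub_zero] at h
  simp only [derivative_mul, eval_add, eval_mul] at h
  rw [intervalIntegral.integral_add (by apply Continuous.intervalIntegrable; fun_prop)
    (by apply Continuous.intervalIntegrable; fun_prop)] at h
  linarith

theorem eval_iterate_derivative_eq_zero {n j : ℕ} (hj : j < n) {c : ℝ} (hc : c ^ 2 = 1) :
    (derivative^[j] ((X ^ 2 - 1 : ℝ[X]) ^ n)).eval c = 0 := by
  obtain ⟨r, hr⟩ := pow_sub_dvd_iterate_derivative_pow (X ^ 2 - 1 : ℝ[X]) n j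
  rw [hr, eval_mul, eval_pow]
  simp [hc, Nat.sub_ne_zero_of_lt hj]

/-- Rodrigues' formula and `n` integrations by parts. -/
theorem legendre_isOrthoPoly (n : ℕ) : IsOrthoPoly (fun _ => 1) (-1) 1 n (legendre n) := by
  have hmon : ((X ^ 2 - 1 : ℝ[X]) ^ n).Monic := by
    apply Monic.pow
    have : (X ^ 2 - 1 : ℝ[X]) = X ^ 2 - C 1 := by simp
    rw [this]; exact monic_X_pow_sub_C 1 two_ne_zero
  have hnd : ((X ^ 2 - 1 : ℝ[X]) ^ n).natDegree = 2 * n := by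
    have : (X ^ 2 - 1 : ℝ[X]) = X ^ 2 - C 1 := by simp
    rw [natDegree_pow, this, natDegree_X_pow_sub_C]; ring
  have hk : (1 / (2 ^ n * (n.factorial : ℝ))) ≠ 0 := by positivity
  refine ⟨?_, fun r hr => ?_⟩
  · rw [legendre, degree_C_mul hk]
    apply degree_eq_of_le_of_coeff_ne_zero
    · refine degree_le_of_natDegree_le ((natDegree_iterate_derivative _ _).trans ?_)
      rw [hnd]; omega
    · rw [coeff_iterate_derivative, ← two_mul, ← hnd, hmon.coeff_natDegree, hnd]
      simp [Nat.descFactorial_eq_zero_iff_lt]; omega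
  · have key : ∀ j ≤ n, ∫ x in (-1 : ℝ)..1,
        (derivative^[n] ((X ^ 2 - 1 : ℝ[X]) ^ n)).eval x * r.eval x =
        (-1) ^ j * ∫ x in (-1 : ℝ)..1,
          (derivative^[n - j] ((X ^ 2 - 1 : ℝ[X]) ^ n)).eval x * (derivative^[j] r).eval x := by
      intro j
      induction j with
      | zero => intro _; simp
      | succ j ih =>
        intro hj
        rw [ih (by omega)]
        have e : n - j = (n - (j + 1)) + 1 := by omega
        rw [e, Function.iterate_succ_apply', integral_derivative_mul, Function.iterate_succ_apply',
          pow_succ]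
        · ring
        · rw [eval_mul, eval_iterate_derivative_eq_zero (by omega) (by norm_num), zero_mul]
        · rw [eval_mul, eval_iterate_derivative_eq_zero (by omega) (by norm_num), zero_mul]
    have h := key n le_rfl
    have hz : derivative^[n] r = 0 := by
      rcases eq_or_ne r 0 with rfl | hr0
      · simp
      · apply iterate_derivative_eq_zero
        rw [degree_eq_natDegree hr0] at hr; exact_mod_cast hr
    rw [hz] at h
    simp only [eval_zero, mul_zero, intervalIntegral.integral_zero] at h
    have : (fun x => (legendre n).eval x) = fun x => (1 / (2 ^ n * (n.factorial : ℝ))) *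
        (derivative^[n] ((X ^ 2 - 1 : ℝ[X]) ^ n)).eval x := by
      ext x; rw [legendre, eval_mul, eval_C]
    rw [this, ip_const_mul_left]
    simp [ip, h]

/-! ### Best approximation in the weighted norm and superconvergence points -/

theorem exists_sq_eval_le_integral_ref (n : ℕ) :
    ∃ κ : ℝ, 0 ≤ κ ∧ ∀ Q : ℝ[X], Q.degree < n → ∀ x ∈ Icc (-1 : ℝ) 1,
      Q.eval x ^ 2 ≤ κ * ip (fun _ => 1) (-1) 1 (fun x => Q.eval x) (fun x => Q.eval x) := by
  have h01 : (-1 : ℝ) < 1 := by norm_num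
  have hw := isWeight_one
  induction n with
  | zero =>
    refine ⟨0, le_rfl, fun Q hQ x _ => ?_⟩
    have : Q = 0 := by
      rw [← degree_eq_bot]; exact Nat.WithBot.lt_zero_iff.1 (by simpa using hQ)
    simp [this]
  | succ n ih =>
    obtain ⟨κ, hκ, h⟩ := ih
    set P := legendre n
    have hP : IsOrthoPoly (fun _ => 1) (-1) 1 n P := legendre_isOrthoPoly n
    have hPP := ip_self_pos hw h01 hP.ne_zero
    obtain ⟨B, hB⟩ := isCompact_Icc.exists_bound_of_continuousOn
      (f := fun x => P.eval x) (s := Icc (-1 : ℝ) 1) (by fun_prop)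
    set m := ip (fun _ => 1) (-1) 1 (fun x => P.eval x) (fun x => P.eval x) with hm
    refine ⟨2 * κ + 2 * (B ^ 2 / m), by positivity, fun Q hQ x hx => ?_⟩
    obtain ⟨c, r, hr, rfl⟩ := exists_eq_C_mul_add hP.degree_eq hQ
    have e : (fun x => (C c * P + r).eval x) = fun x => c * P.eval x + r.eval x := by
      ext x; simp only [eval_add, eval_mul, eval_C]
    have hrP := hP.ortho r hr
    have hsplit : ip (fun _ => 1) (-1) 1 (fun x => (C c * P + r).eval x)
        (fun x => (C c * P + r).eval x) =
        c ^ 2 * m + ip (fun _ => 1) (-1) 1 (fun x => r.eval x) (fun x => r.eval x) := by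
      rw [e, ip_add_left hw (by fun_prop) (by fun_prop) (by fun_prop),
        ip_add_right hw (by fun_prop) (by fun_prop) (by fun_prop),
        ip_add_right hw (by fun_prop) (by fun_prop) (by fun_prop), ip_const_mul_left,
        ip_const_mul_left, ip_const_mul_right, ip_const_mul_right,
        ip_comm _ _ _ (fun x => r.eval x) (fun x => P.eval x), hrP]
      ring
    have hrr : 0 ≤ ip (fun _ => 1) (-1) 1 (fun x => r.eval x) (fun x => r.eval x) := by
      unfold ip
      refine intervalIntegral.integral_nonneg h01.le fun x _ => ?_
      rw [one_mul]; exact mul_self_nonneg _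
    have hPx : P.eval x ^ 2 ≤ B ^ 2 := by
      rw [← sq_abs]; exact pow_le_pow_left₀ (abs_nonneg _) (hB x hx) 2
    have h1 := h r hr x hx
    rw [hsplit, eval_add, eval_mul, eval_C]
    have h2 : (c * P.eval x + r.eval x) ^ 2 ≤ 2 * (c ^ 2 * P.eval x ^ 2) + 2 * r.eval x ^ 2 := by
      nlinarith [sq_nonneg (c * P.eval x - r.eval x)]
    have h3 : c ^ 2 * P.eval x ^ 2 ≤ c ^ 2 * B ^ 2 :=
      mul_le_mul_of_nonneg_left hPx (sq_nonneg c)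
    have h4 : c ^ 2 * B ^ 2 = (B ^ 2 / m) * (c ^ 2 * m) := by field_simp
    have h5 : 0 ≤ κ * (c ^ 2 * m) := by positivity
    have h6 : 0 ≤ (B ^ 2 / m) *
        ip (fun _ => 1) (-1) 1 (fun x => r.eval x) (fun x => r.eval x) := by positivity
    nlinarith

/-- Inverse inequality: on an interval, the maximum of a polynomial is bounded by its `L²` norm,
with a constant that depends only on the degree once the length of the interval is scaled out. -/
theorem exists_sq_eval_le_integral (n : ℕ) :
    ∃ κ : ℝ, 0 ≤ κ ∧ ∀ x0 x1 : ℝ, x0 < x1 → ∀ Q : ℝ[X], Q.degree < n → ∀ x ∈ Icc x0 x1,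
      Q.eval x ^ 2 * (x1 - x0) ≤
        κ * ip (fun _ => 1) x0 x1 (fun x => Q.eval x) (fun x => Q.eval x) := by
  obtain ⟨κ, hκ, h⟩ := exists_sq_eval_le_integral_ref n
  refine ⟨2 * κ, by positivity, fun x0 x1 h01 Q hQ x hx => ?_⟩
  have hh : 0 < x1 - x0 := sub_pos.2 h01
  have h2 : (x1 - x0) / 2 ≠ 0 := by positivity
  set B : ℝ[X] := C ((x1 - x0) / 2) * X + C ((x0 + x1) / 2) with hB
  have hB1 : B.natDegree = 1 := natDegree_linear h2
  have hQB : (Q.comp B).degree < n := by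
    rcases eq_or_ne Q 0 with rfl | hQ0
    · simp
    · refine degree_le_natDegree.trans_lt ?_
      rw [natDegree_comp, hB1, mul_one, ← degree_eq_natDegree hQ0]
      exact hQ
  have key := intervalIntegral.integral_comp_mul_add (a := -1) (b := 1)
    (f := fun y => 1 * (Q.eval y * Q.eval y)) h2 ((x0 + x1) / 2)
  have e0 : (x1 - x0) / 2 * -1 + (x0 + x1) / 2 = x0 := by ring
  have e1 : (x1 - x0) / 2 * 1 + (x0 + x1) / 2 = x1 := by ring
  rw [e0, e1, smul_eq_mul] at key
  have hξ : (2 * x - x0 - x1) / (x1 - x0) ∈ Icc (-1 : ℝ) 1 := by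
    constructor
    · rw [le_div_iff₀ hh]; linarith [hx.1]
    · rw [div_le_iff₀ hh]; linarith [hx.2]
  have h3 := h _ hQB _ hξ
  have e3 : (x1 - x0) / 2 * ((2 * x - x0 - x1) / (x1 - x0)) + (x0 + x1) / 2 = x := by
    field_simp; ring
  simp only [ip, eval_comp, hB, eval_add, eval_mul, eval_C, eval_X, e3] at h3
  rw [key] at h3
  unfold ip
  calc Q.eval x ^ 2 * (x1 - x0) ≤ κ * (((x1 - x0) / 2)⁻¹ *
      ∫ x in x0..x1, 1 * (Q.eval x * Q.eval x)) * (x1 - x0) :=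
        mul_le_mul_of_nonneg_right h3 hh.le
    _ = _ := by field_simp

/-- The stability constant `1 + √(κ ρ)` of the weighted `L²` projection onto polynomials of degree
less than `p + 1`, where `κ` is the constant of the inverse inequality. -/
def stab (p : ℕ) (ρ : ℝ) : ℝ :=
  1 + √((exists_sq_eval_le_integral (p + 1)).choose * ρ)

theorem stab_nonneg (p : ℕ) (ρ : ℝ) : 0 ≤ stab p ρ := by unfold stab; positivity

/-- Let `q` be the weighted `L²` projection of `G` onto polynomials of degree less than `p`, and let
`G` be `δ`-close to a polynomial `T` of degree at most `p`. Then `G - q` is a multiple of the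
orthogonal polynomial `L` of degree `p`, up to an error of order `δ`: subtracting that multiple
gives the error of the projection onto degree at most `p`, which is stable in the maximum norm. -/
theorem exists_abs_sub_le_of_ortho {w : ℝ → ℝ} {lo hi x0 x1 : ℝ} (hw : IsWeight w lo hi)
    (h01 : x0 < x1) {p : ℕ} {L q T : ℝ[X]} (hL : IsOrthoPoly w x0 x1 p L) (hq : q.degree < p)
    {G : ℝ → ℝ} (hG : Continuous G)
    (horth : ∀ r : ℝ[X], r.degree < p →
      ip w x0 x1 (fun x => G x - q.eval x) (fun x => r.eval x) = 0)
    (hT : T.degree < ((p + 1 : ℕ) : WithBot ℕ)) {δ : ℝ}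
    (hGT : ∀ x ∈ Icc x0 x1, |G x - T.eval x| ≤ δ) :
    ∃ c : ℝ, ∀ x ∈ Icc x0 x1, |G x - q.eval x - c * L.eval x| ≤ stab p (hi / lo) * δ := by
  have hLL := ip_self_pos hw h01 hL.ne_zero
  have hh : 0 < x1 - x0 := sub_pos.2 h01
  have hδ : 0 ≤ δ := (abs_nonneg _).trans (hGT x0 (left_mem_Icc.2 h01.le))
  set ll := ip w x0 x1 (fun x => L.eval x) (fun x => L.eval x) with hll
  set c := ip w x0 x1 (fun x => G x - q.eval x) (fun x => L.eval x) / ll with hc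
  have hE : ∀ r : ℝ[X], r.degree < ((p + 1 : ℕ) : WithBot ℕ) →
      ip w x0 x1 (fun x => G x - q.eval x - c * L.eval x) (fun x => r.eval x) = 0 := by
    intro r hr
    obtain ⟨d, s, hs, rfl⟩ := exists_eq_C_mul_add hL.degree_eq hr
    have e : (fun x => (C d * L + s).eval x) = fun x => d * L.eval x + s.eval x := by
      ext x; simp only [eval_add, eval_mul, eval_C]
    have h1 : ip w x0 x1 (fun x => G x - q.eval x - c * L.eval x) (fun x => L.eval x) = 0 := by
      rw [ip_sub_left hw (by fun_prop) (by fun_prop) (by fun_prop), ip_const_mul_left, hc]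
      field_simp; ring
    have h2 : ip w x0 x1 (fun x => G x - q.eval x - c * L.eval x) (fun x => s.eval x) = 0 := by
      rw [ip_sub_left hw (by fun_prop) (by fun_prop) (by fun_prop), ip_const_mul_left,
        horth s hs, hL.ortho s hs]
      ring
    rw [e, ip_add_right hw (by fun_prop) (by fun_prop) (by fun_prop), ip_const_mul_right, h1, h2]
    ring
  set S : ℝ[X] := T - q - C c * L with hS
  have hSd : S.degree < ((p + 1 : ℕ) : WithBot ℕ) := by
    have hp1 : ((p : ℕ) : WithBot ℕ) < ((p + 1 : ℕ) : WithBot ℕ) := by exact_mod_cast p.lt_succ_self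
    refine (degree_sub_le _ _).trans_lt (max_lt ((degree_sub_le _ _).trans_lt
      (max_lt hT (hq.trans hp1))) ?_)
    rw [← smul_eq_C_mul]
    exact (degree_smul_le c L).trans_lt (by rw [hL.degree_eq]; exact hp1)
  have hSx : ∀ x, S.eval x = T.eval x - q.eval x - c * L.eval x := by
    intro x; simp only [hS, eval_sub, eval_mul, eval_C]
  -- Pythagoras: `G - T = (G - q - c L) - S`, and the first summand is orthogonal to `S`
  have hpyth : ip w x0 x1 (fun x => S.eval x) (fun x => S.eval x) ≤
      ip w x0 x1 (fun x => G x - T.eval x) (fun x => G x - T.eval x) := by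
    have hES := hE S hSd
    have e : (fun x => G x - T.eval x) =
        fun x => (G x - q.eval x - c * L.eval x) - S.eval x := by
      ext x; rw [hSx]; ring
    have key : ∀ E : ℝ → ℝ, Continuous E → ip w x0 x1 E (fun x => S.eval x) = 0 →
        ip w x0 x1 (fun x => S.eval x) (fun x => S.eval x) ≤
          ip w x0 x1 (fun x => E x - S.eval x) (fun x => E x - S.eval x) := by
      intro E hE hES
      have hEE : 0 ≤ ip w x0 x1 E E := by
        unfold ip
        exact intervalIntegral.integral_nonneg h01.le fun x _ =>
          mul_nonneg (hw.pos x).le (mul_self_nonneg _)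
      rw [ip_sub_left hw (by fun_prop) (by fun_prop) (by fun_prop),
        ip_sub_right hw (by fun_prop) (by fun_prop) (by fun_prop),
        ip_sub_right hw (by fun_prop) (by fun_prop) (by fun_prop), hES,
        ip_comm w x0 x1 (fun x => S.eval x) E, hES]
      linarith
    rw [e]
    exact key _ (by fun_prop) hES
  have hRR : ip w x0 x1 (fun x => G x - T.eval x) (fun x => G x - T.eval x) ≤
      (x1 - x0) * (hi * δ ^ 2) := by
    have : (x1 - x0) * (hi * δ ^ 2) = ∫ _ in x0..x1, hi * δ ^ 2 := by
      rw [intervalIntegral.integral_const, smul_eq_mul]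
    rw [this]
    unfold ip
    refine intervalIntegral.integral_mono_on h01.le (hw.integrable (by fun_prop) _ _)
      intervalIntegrable_const fun x hx => ?_
    refine mul_le_mul (hw.le_hi x) ?_ (mul_self_nonneg _) hw.hi_pos.le
    rw [← pow_two, ← sq_abs]
    exact pow_le_pow_left₀ (abs_nonneg _) (hGT x hx) 2
  have hSS : lo * ip (fun _ => 1) x0 x1 (fun x => S.eval x) (fun x => S.eval x) ≤
      ip w x0 x1 (fun x => S.eval x) (fun x => S.eval x) := by
    unfold ip
    rw [← intervalIntegral.integral_const_mul]
    refine intervalIntegral.integral_mono_on h01.le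
      (by apply Continuous.intervalIntegrable; fun_prop) (hw.integrable (by fun_prop) _ _)
      fun x hx => ?_
    rw [one_mul]
    exact mul_le_mul_of_nonneg_right (hw.lo_le x) (mul_self_nonneg _)
  refine ⟨c, fun x hx => ?_⟩
  obtain ⟨hκ, hinv⟩ := (exists_sq_eval_le_integral (p + 1)).choose_spec
  have hstab : stab p (hi / lo) =
    1 + √((exists_sq_eval_le_integral (p + 1)).choose * (hi / lo)) := rfl
  generalize (exists_sq_eval_le_integral (p + 1)).choose = κ at hκ hinv hstab
  have hsq : S.eval x ^ 2 ≤ κ * (hi / lo) * δ ^ 2 := by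
    have h1 := hinv x0 x1 h01 S hSd x hx
    have h2 : ip (fun _ => 1) x0 x1 (fun x => S.eval x) (fun x => S.eval x) ≤
        (x1 - x0) * (hi * δ ^ 2) / lo := by
      rw [le_div_iff₀ hw.lo_pos]; linarith
    have h3 := h1.trans (mul_le_mul_of_nonneg_left h2 hκ)
    refine le_of_mul_le_mul_right (h3.trans_eq ?_) hh
    have := hw.lo_pos.ne'
    field_simp
  have hSabs : |S.eval x| ≤ √(κ * (hi / lo)) * δ := by
    have : √(κ * (hi / lo)) * δ = √(κ * (hi / lo) * δ ^ 2) := by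
      rw [Real.sqrt_mul' _ (sq_nonneg δ), Real.sqrt_sq hδ]
    rw [this]
    exact Real.abs_le_sqrt hsq
  have : G x - q.eval x - c * L.eval x = (G x - T.eval x) + S.eval x := by rw [hSx]; ring
  rw [this, hstab]
  calc |(G x - T.eval x) + S.eval x| ≤ |G x - T.eval x| + |S.eval x| := abs_add_le _ _
    _ ≤ δ + √(κ * (hi / lo)) * δ := add_le_add (hGT x hx) hSabs
    _ = _ := by ring

/-! ### Piecewise differentiable functions and their weak derivatives -/

/-- `v` is continuous on `[c, d]` and, off a finite subset of `(c, d)`, differentiable with bounded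
derivative. -/
structure PiecewiseDiff (c d : ℝ) (v : ℝ → ℝ) : Prop where
  continuousOn : ContinuousOn v (Icc c d)
  deriv_bdd : ∃ (s : Set ℝ) (B : ℝ), s.Finite ∧
    ∀ x ∈ Ioo c d, x ∉ s → DifferentiableAt ℝ v x ∧ |deriv v x| ≤ B

section

variable {c d : ℝ} {v z : ℝ → ℝ}

theorem ae_notMem_of_finite {s : Set ℝ} (hs : s.Finite) (μ : Measure ℝ) [NullSingletonClass μ] :
    ∀ᵐ x ∂μ, x ∉ s :=
  measure_eq_zero_iff_ae_notMem.1 (hs.measure_zero μ)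

theorem PiecewiseDiff.ae_bound (hv : PiecewiseDiff c d v) :
    ∃ B : ℝ, ∀ᵐ x ∂volume.restrict (Ioo c d), ‖deriv v x‖ ≤ B := by
  obtain ⟨s, B, hs, h⟩ := hv.deriv_bdd
  refine ⟨B, ?_⟩
  filter_upwards [ae_notMem_of_finite hs (volume.restrict (Ioo c d)),
    ae_restrict_mem measurableSet_Ioo] with x hx hxI
  exact (h x hxI hx).2

theorem PiecewiseDiff.memLp_deriv (hv : PiecewiseDiff c d v) (q : ℝ≥0∞) :
    MemLp (deriv v) q (volume.restrict (Ioo c d)) := by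
  obtain ⟨B, hB⟩ := hv.ae_bound
  exact MemLp.of_bound (measurable_deriv v).aestronglyMeasurable B hB

theorem PiecewiseDiff.memLp (hv : PiecewiseDiff c d v) (q : ℝ≥0∞) :
    MemLp v q (volume.restrict (Ioo c d)) := by
  obtain ⟨B, hB⟩ := isCompact_Icc.exists_bound_of_continuousOn hv.continuousOn
  refine MemLp.of_bound ((hv.continuousOn.mono Ioo_subset_Icc_self).aestronglyMeasurable
    measurableSet_Ioo) B ?_
  filter_upwards [ae_restrict_mem measurableSet_Ioo] with x hx
  exact hB x (Ioo_subset_Icc_self hx)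

theorem PiecewiseDiff.intervalIntegrable_deriv (hv : PiecewiseDiff c d v) (hcd : c ≤ d) :
    IntervalIntegrable (deriv v) volume c d := by
  rw [intervalIntegrable_iff_integrableOn_Ioo_of_le hcd]
  exact memLp_one_iff_integrable.1 (hv.memLp_deriv 1)

theorem PiecewiseDiff.intervalIntegrable_deriv_mul (hv : PiecewiseDiff c d v) (hcd : c ≤ d)
    {g : ℝ → ℝ} (hg : ContinuousOn g (Icc c d)) :
    IntervalIntegrable (fun x => deriv v x * g x) volume c d :=
  (hv.intervalIntegrable_deriv hcd).mul_continuousOn (by rwa [uIcc_of_le hcd])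

theorem PiecewiseDiff.integral_parts (hv : PiecewiseDiff c d v) (hz : PiecewiseDiff c d z)
    (hcd : c ≤ d) :
    ∫ x in c..d, (deriv v x * z x + v x * deriv z x) = v d * z d - v c * z c := by
  obtain ⟨s, B, hs, h⟩ := hv.deriv_bdd
  obtain ⟨t, B', ht, h'⟩ := hz.deriv_bdd
  refine integral_eq_of_hasDerivAt_off_countable_of_le (fun x => v x * z x) _ hcd
    (hs.union ht).countable (hv.continuousOn.mul hz.continuousOn) (fun x hx => ?_) ?_
  · have hxs : x ∉ s := fun h => hx.2 (Or.inl h)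
    have hxt : x ∉ t := fun h => hx.2 (Or.inr h)
    exact (h x hx.1 hxs).1.hasDerivAt.mul (h' x hx.1 hxt).1.hasDerivAt
  · refine (hv.intervalIntegrable_deriv_mul hcd hz.continuousOn).add ?_
    simpa only [mul_comm] using hz.intervalIntegrable_deriv_mul hcd hv.continuousOn

theorem PiecewiseDiff.mono (hv : PiecewiseDiff c d v) {c' d' : ℝ} (hc : c ≤ c') (hd : d' ≤ d) :
    PiecewiseDiff c' d' v := by
  obtain ⟨s, B, hs, h⟩ := hv.deriv_bdd
  exact ⟨hv.continuousOn.mono (Icc_subset_Icc hc hd), s, B, hs,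
    fun x hx => h x (Ioo_subset_Ioo hc hd hx)⟩

theorem PiecewiseDiff.of_contDiff (hv : ContDiff ℝ 1 v) (c d : ℝ) : PiecewiseDiff c d v := by
  obtain ⟨B, hB⟩ := (isCompact_Icc (a := c) (b := d)).exists_bound_of_continuousOn
    (hv.continuous_deriv le_rfl).continuousOn
  exact ⟨hv.continuous.continuousOn, ∅, B, finite_empty,
    fun x hx _ => ⟨hv.differentiable one_ne_zero x, hB x (Ioo_subset_Icc_self hx)⟩⟩

theorem PiecewiseDiff.integral_deriv (hv : PiecewiseDiff c d v) (hcd : c ≤ d) :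
    ∫ x in c..d, deriv v x = v d - v c := by
  simpa using hv.integral_parts (PiecewiseDiff.of_contDiff (contDiff_const (c := (1 : ℝ))) c d) hcd

theorem PiecewiseDiff.sub (hv : PiecewiseDiff c d v) (hz : PiecewiseDiff c d z) :
    PiecewiseDiff c d (fun x => v x - z x) := by
  obtain ⟨s, B, hs, h⟩ := hv.deriv_bdd
  obtain ⟨t, B', ht, h'⟩ := hz.deriv_bdd
  refine ⟨hv.continuousOn.sub hz.continuousOn, s ∪ t, B + B', hs.union ht, fun x hx hxs => ?_⟩
  obtain ⟨h1, h2⟩ := h x hx fun h => hxs (Or.inl h)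
  obtain ⟨h3, h4⟩ := h' x hx fun h => hxs (Or.inr h)
  refine ⟨h1.sub h3, ?_⟩
  rw [deriv_fun_sub h1 h3]
  exact (abs_sub _ _).trans (add_le_add h2 h4)

theorem PiecewiseDiff.ae_deriv_sub (hv : PiecewiseDiff c d v) (hz : PiecewiseDiff c d z) :
    ∀ᵐ x, x ∈ Ioo c d → deriv (fun x => v x - z x) x = deriv v x - deriv z x := by
  obtain ⟨s, B, hs, h⟩ := hv.deriv_bdd
  obtain ⟨t, B', ht, h'⟩ := hz.deriv_bdd
  filter_upwards [ae_notMem_of_finite (hs.union ht) volume] with x hxs hx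
  exact deriv_fun_sub (h x hx fun h => hxs (Or.inl h)).1 (h' x hx fun h => hxs (Or.inr h)).1

theorem hasWeakDeriv_zero {v : ℝ → ℝ} {I : Set ℝ} (hv : LocallyIntegrableOn v I) :
    HasWeakDeriv 0 I v v :=
  ⟨hv, hv, fun η _ _ _ => by simp⟩

/-- The classical derivative of a piecewise differentiable function is its weak derivative. -/
theorem PiecewiseDiff.hasWeakDeriv (hv : PiecewiseDiff c d v) (hcd : c ≤ d) :
    HasWeakDeriv 1 (Ioo c d) v (deriv v) := by
  have hvi : IntegrableOn v (Ioo c d) := memLp_one_iff_integrable.1 (hv.memLp 1)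
  have hvi' : IntegrableOn (deriv v) (Ioo c d) := memLp_one_iff_integrable.1 (hv.memLp_deriv 1)
  refine ⟨hvi.locallyIntegrableOn, hvi'.locallyIntegrableOn, fun η hη _ hsupp => ?_⟩
  have hη1 : ContDiff ℝ 1 η := hη.of_le (by exact_mod_cast le_top)
  have h := hv.integral_parts (PiecewiseDiff.of_contDiff hη1 c d) hcd
  have hηc : η c = 0 := by
    by_contra h
    exact lt_irrefl c (hsupp (subset_tsupport η h)).1
  have hηd : η d = 0 := by
    by_contra h
    exact lt_irrefl d (hsupp (subset_tsupport η h)).2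
  have hi : IntervalIntegrable (fun x => v x * deriv η x) volume c d :=
    (hv.continuousOn.mul (hη1.continuous_deriv le_rfl).continuousOn).intervalIntegrable_of_Icc hcd
  rw [hηc, hηd, mul_zero, mul_zero, sub_zero, intervalIntegral.integral_add
    (hv.intervalIntegrable_deriv_mul hcd hη.continuous.continuousOn) hi] at h
  rw [← integral_Ioc_eq_integral_Ioo, ← integral_Ioc_eq_integral_Ioo,
    ← intervalIntegral.integral_of_le hcd, ← intervalIntegral.integral_of_le hcd, iteratedDeriv_one]
  linarith

theorem PiecewiseDiff.memH10 (hv : PiecewiseDiff c d v) (hcd : c ≤ d) (hc : v c = 0)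
    (hd : v d = 0) : MemH10 c d v := by
  refine ⟨fun j hj => ?_, hv.continuousOn, hc, hd⟩
  interval_cases j
  · exact ⟨v, hasWeakDeriv_zero (hv.hasWeakDeriv hcd).1, hv.memLp 2⟩
  · exact ⟨deriv v, hv.hasWeakDeriv hcd, hv.memLp_deriv 2⟩

end

/-! ### Functions with bounded weak derivatives are classically differentiable -/

section

variable {c d : ℝ}

theorem integrableOn_mul_of_tsupport_subset {I : Set ℝ} {z η : ℝ → ℝ} (hz : LocallyIntegrableOn z I)
    (hη : Continuous η) (hc : HasCompactSupport η) (hs : tsupport η ⊆ I) :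
    Integrable (fun x => z x * η x) := by
  have h1 : IntegrableOn z (tsupport η) := hz.integrableOn_compact_subset hs hc
  have h2 : IntegrableOn (fun x => z x * η x) (tsupport η) :=
    h1.mul_continuousOn hη.continuousOn hc
  refine (integrableOn_iff_integrable_of_support_subset ?_).1 h2
  exact (Function.support_mul_subset_right _ _).trans (subset_tsupport η)

/-- Fundamental lemma of the calculus of variations on an open set. -/
theorem ae_eq_of_forall_setIntegral_mul_eq {I : Set ℝ} (hI : IsOpen I) {f g : ℝ → ℝ}
    (hf : LocallyIntegrableOn f I) (hg : LocallyIntegrableOn g I)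
    (h : ∀ η : ℝ → ℝ, ContDiff ℝ ∞ η → HasCompactSupport η → tsupport η ⊆ I →
      ∫ x in I, f x * η x = ∫ x in I, g x * η x) :
    ∀ᵐ x, x ∈ I → f x = g x := by
  have key := hI.ae_eq_zero_of_integral_contDiff_smul_eq_zero (hf.sub hg) fun η hη hc hs => by
    have h1 := (integrableOn_mul_of_tsupport_subset hf hη.continuous hc hs).integrableOn (s := I)
    have h2 := (integrableOn_mul_of_tsupport_subset hg hη.continuous hc hs).integrableOn (s := I)
    rw [← setIntegral_eq_integral_of_forall_compl_eq_zero (s := I)]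
    · have : (fun x => η x • (f - g) x) = fun x => f x * η x - g x * η x := by
        ext x; simp only [Pi.sub_apply, smul_eq_mul]; ring
      rw [this, integral_sub h1 h2, h η hη hc hs, sub_self]
    · intro x hx
      rw [image_eq_zero_of_notMem_tsupport fun hxs => hx (hs hxs), zero_smul]
  filter_upwards [key] with x hx hxI
  exact sub_eq_zero.1 (hx hxI)

theorem HasWeakDeriv.ae_eq {n : ℕ} {I : Set ℝ} (hI : IsOpen I) {v g g' : ℝ → ℝ}
    (h : HasWeakDeriv n I v g) (h' : HasWeakDeriv n I v g') : ∀ᵐ x, x ∈ I → g x = g' x := by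
  refine ae_eq_of_forall_setIntegral_mul_eq hI h.2.1 h'.2.1 fun η hη hc hs => ?_
  have := (h.2.2 η hη hc hs).symm.trans (h'.2.2 η hη hc hs)
  exact mul_left_cancel₀ (pow_ne_zero n (by norm_num)) this

/-- A test function on `(c, d)` with integral zero is the derivative of a test function. -/
theorem exists_test_primitive {ζ : ℝ → ℝ} (hζ : ContDiff ℝ ∞ ζ) (hc : HasCompactSupport ζ)
    (hs : tsupport ζ ⊆ Ioo c d) (h0 : ∫ x, ζ x = 0) :
    ∃ η : ℝ → ℝ, ContDiff ℝ ∞ η ∧ HasCompactSupport η ∧ tsupport η ⊆ Ioo c d ∧ deriv η = ζ := by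
  rcases (tsupport ζ).eq_empty_or_nonempty with he | hne
  · have : ζ = 0 := tsupport_eq_empty_iff.1 he
    refine ⟨0, contDiff_const, HasCompactSupport.zero, by simp, ?_⟩
    rw [this]; exact deriv_const' 0
  obtain ⟨c', hc', hlo⟩ := hc.isCompact.exists_isLeast hne
  obtain ⟨d', hd', hup⟩ := hc.isCompact.exists_isGreatest hne
  have hcc' : c < c' := (hs hc').1
  have hdd' : d' < d := (hs hd').2
  have hz : ∀ x, x ∉ Icc c' d' → ζ x = 0 := fun x hx =>
    image_eq_zero_of_notMem_tsupport fun h => hx ⟨hlo h, hup h⟩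
  have hder : ∀ x, HasDerivAt (fun x => ∫ t in c..x, ζ t) (ζ x) x := fun x =>
    intervalIntegral.integral_hasDerivAt_right (hζ.continuous.intervalIntegrable _ _)
      (hζ.continuous.stronglyMeasurableAtFilter _ _) hζ.continuous.continuousAt
  have hderiv : deriv (fun x => ∫ t in c..x, ζ t) = ζ := funext fun x => (hder x).deriv
  have hsub : Function.support (fun x => ∫ t in c..x, ζ t) ⊆ Icc c' d' := by
    intro x hx
    by_contra hxn
    apply hx
    rcases lt_or_ge x c' with h | h
    · refine intervalIntegral.integral_zero_ae (Eventually.of_forall fun y hy => hz y fun hy' => ?_)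
      have : y ≤ max c x := hy.2
      exact absurd (hy'.1.trans this) (not_le.2 (max_lt hcc' h))
    · have hxd : d' < x := by
        by_contra hxd; exact hxn ⟨h, not_lt.1 hxd⟩
      change ∫ t in c..x, ζ t = 0
      rw [intervalIntegral.integral_eq_integral_of_support_subset, h0]
      intro y hy
      have : y ∈ Icc c' d' := by
        by_contra hyn; exact hy (hz y hyn)
      exact ⟨hcc'.trans_le this.1, this.2.trans hxd.le⟩
  have htsub : tsupport (fun x => ∫ t in c..x, ζ t) ⊆ Icc c' d' :=
    closure_minimal hsub isClosed_Icc
  refine ⟨_, ?_, ?_, htsub.trans fun x hx => ⟨hcc'.trans_le hx.1, hx.2.trans_lt hdd'⟩, hderiv⟩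
  · rw [contDiff_infty_iff_deriv, hderiv]
    exact ⟨fun x => (hder x).differentiableAt, hζ⟩
  · exact HasCompactSupport.of_support_subset_isCompact isCompact_Icc hsub

/-- Lemma of du Bois-Reymond: a function with vanishing weak derivative is constant. -/
theorem exists_ae_eq_const (hcd : c < d) {z : ℝ → ℝ} (hz : LocallyIntegrableOn z (Ioo c d))
    (h : ∀ η : ℝ → ℝ, ContDiff ℝ ∞ η → HasCompactSupport η → tsupport η ⊆ Ioo c d →
      ∫ x in Ioo c d, z x * deriv η x = 0) :
    ∃ C : ℝ, ∀ᵐ x, x ∈ Ioo c d → z x = C := by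
  let B : ContDiffBump ((c + d) / 2) := ⟨(d - c) / 8, (d - c) / 4, by linarith, by linarith⟩
  set η₀ := B.normed volume with hη₀
  have hsm : ContDiff ℝ ∞ η₀ := B.contDiff_normed
  have hcs : HasCompactSupport η₀ := B.hasCompactSupport_normed
  have hts : tsupport η₀ ⊆ Ioo c d := by
    rw [hη₀, B.tsupport_normed_eq, Real.closedBall_eq_Icc]
    intro x hx
    constructor
    · have := hx.1; simp only [B] at this; linarith
    · have := hx.2; simp only [B] at this; linarith
  have hint : ∫ x, η₀ x = 1 := B.integral_normed
  refine ⟨∫ x in Ioo c d, z x * η₀ x, ae_eq_of_forall_setIntegral_mul_eq isOpen_Ioo hz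
    ((locallyIntegrable_const _).locallyIntegrableOn _) fun φ hφ hφc hφs => ?_⟩
  set m := ∫ x, φ x with hm
  -- subtract a multiple of a fixed bump so that the test function gets integral zero
  have hζs : tsupport (fun x => φ x - m * η₀ x) ⊆ tsupport φ ∪ tsupport η₀ := by
    refine (tsupport_sub φ (fun x => m * η₀ x)).trans (union_subset_union_right _ ?_)
    exact tsupport_mul_subset_right
  have hφi : Integrable φ := hφ.continuous.integrable_of_hasCompactSupport hφc
  have hηi : Integrable η₀ := hsm.continuous.integrable_of_hasCompactSupport hcs
  obtain ⟨η, hη, hηc, hηs, hd⟩ := exists_test_primitive (c := c) (d := d)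
    (ζ := fun x => φ x - m * η₀ x) (hφ.sub (contDiff_const.mul hsm))
    (HasCompactSupport.of_support_subset_isCompact (hφc.isCompact.union hcs.isCompact)
      ((subset_tsupport _).trans hζs))
    (hζs.trans (union_subset hφs hts))
    (by rw [integral_sub hφi (hηi.const_mul m), integral_const_mul, hint, ← hm]; ring)
  have h1 := h η hη hηc hηs
  have e : (fun x => z x * deriv η x) = fun x => z x * φ x - m * (z x * η₀ x) := by
    ext x; rw [hd]; ring
  have i1 := integrableOn_mul_of_tsupport_subset hz hφ.continuous hφc hφs
  have i2 := integrableOn_mul_of_tsupport_subset hz hsm.continuous hcs hts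
  rw [e, integral_sub i1.integrableOn (i2.const_mul m).integrableOn, integral_const_mul,
    sub_eq_zero] at h1
  rw [h1, integral_const_mul, mul_comm m, hm,
    setIntegral_eq_integral_of_forall_compl_eq_zero (f := φ)]
  intro x hx
  exact image_eq_zero_of_notMem_tsupport fun hxs => hx (hφs hxs)

/-- Integration by parts for the primitive of an integrable function against a test function. -/
theorem integral_primitive_mul_deriv (hcd : c < d) {G η : ℝ → ℝ}
    (hG : Integrable G) (hη : ContDiff ℝ ∞ η) (hc : HasCompactSupport η)
    (hs : tsupport η ⊆ Ioo c d) :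
    ∫ x in Ioo c d, (∫ t in c..x, G t) * deriv η x = -∫ x in Ioo c d, G x * η x := by
  have hGi : IntervalIntegrable G volume c d := hG.intervalIntegrable
  have hV := hGi.absolutelyContinuousOnInterval_intervalIntegral (c := c) (by simp)
  have hη1 : ContDiff ℝ 1 η := hη.of_le (by exact_mod_cast le_top)
  obtain ⟨C, hC⟩ := hη1.lipschitzWith_of_hasCompactSupport hc one_ne_zero
  have hηa : AbsolutelyContinuousOnInterval η c d :=
    (hC.lipschitzOnWith (s := uIcc c d)).absolutelyContinuousOnInterval
  have h := hV.integral_mul_deriv_eq_deriv_mul hηa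
  have hηd : η d = 0 := image_eq_zero_of_notMem_tsupport fun h => lt_irrefl d (hs h).2
  have hηc : η c = 0 := image_eq_zero_of_notMem_tsupport fun h => lt_irrefl c (hs h).1
  rw [hηd, hηc] at h
  rw [← integral_Ioc_eq_integral_Ioo, ← integral_Ioc_eq_integral_Ioo,
    ← intervalIntegral.integral_of_le hcd.le, ← intervalIntegral.integral_of_le hcd.le, h]
  simp only [mul_zero, sub_self, zero_sub, neg_inj]
  refine intervalIntegral.integral_congr_ae ?_
  filter_upwards [hGi.ae_hasDerivAt_integral] with x hx hxI
  rw [(hx (uIoc_subset_uIcc hxI) c (by simp)).deriv]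

theorem HasWeakDeriv.of_succ {n : ℕ} {I : Set ℝ} {u g₁ g : ℝ → ℝ} (h₁ : HasWeakDeriv 1 I u g₁)
    (h : HasWeakDeriv (n + 1) I u g) : HasWeakDeriv n I g₁ g := by
  refine ⟨h₁.2.1, h.2.1, fun η hη hc hs => ?_⟩
  have hsm : ContDiff ℝ ∞ (iteratedDeriv n η) := by
    clear h
    induction n with
    | zero => rwa [iteratedDeriv_zero]
    | succ n ih => rw [iteratedDeriv_succ]; exact (contDiff_infty_iff_deriv.1 ih).2
  have hsub : tsupport (iteratedDeriv n η) ⊆ tsupport η := by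
    clear h hsm
    induction n with
    | zero => rw [iteratedDeriv_zero]
    | succ n ih => rw [iteratedDeriv_succ]; exact tsupport_deriv_subset.trans ih
  have h2 := h₁.2.2 (iteratedDeriv n η) hsm (hc.mono' ((subset_tsupport _).trans hsub))
    (hsub.trans hs)
  rw [iteratedDeriv_one, ← iteratedDeriv_succ, h.2.2 η hη hc hs] at h2
  rw [pow_succ] at h2
  linarith

/-- A primitive of `g`, up to a constant, represents a function with weak derivative `g`. -/
theorem exists_ae_eq_primitive (hcd : c < d) {u g G : ℝ → ℝ} (h : HasWeakDeriv 1 (Ioo c d) u g)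
    (hG : Integrable G) (hgG : ∀ᵐ x, x ∈ Ioo c d → g x = G x) :
    ∃ C : ℝ, ∀ᵐ x, x ∈ Ioo c d → u x = C + ∫ t in c..x, G t := by
  have hV : Continuous fun x => ∫ t in c..x, G t :=
    intervalIntegral.continuous_primitive (fun _ _ => hG.intervalIntegrable) c
  obtain ⟨C, hC⟩ := exists_ae_eq_const hcd (z := fun x => u x - ∫ t in c..x, G t)
    (h.1.sub (hV.locallyIntegrable.locallyIntegrableOn _)) fun η hη hc hs => by
      have hη1 : ContDiff ℝ 1 η := hη.of_le (by exact_mod_cast le_top)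
      have hdc : Continuous (deriv η) := hη1.continuous_deriv le_rfl
      have hds : tsupport (deriv η) ⊆ Ioo c d := tsupport_deriv_subset.trans hs
      have h1 := h.2.2 η hη hc hs
      rw [iteratedDeriv_one, pow_one, neg_one_mul] at h1
      have h2 := integral_primitive_mul_deriv hcd hG hη hc hs
      have e : (fun x => (u x - ∫ t in c..x, G t) * deriv η x) =
          fun x => u x * deriv η x - (∫ t in c..x, G t) * deriv η x := by
        ext x; ring
      rw [e, integral_sub (integrableOn_mul_of_tsupport_subset h.1 hdc hc.deriv hds).integrableOn
        (integrableOn_mul_of_tsupport_subset (hV.locallyIntegrable.locallyIntegrableOn _) hdc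
          hc.deriv hds).integrableOn, h1, h2, sub_neg_eq_add, neg_add_eq_zero]
      refine setIntegral_congr_ae measurableSet_Ioo ?_
      filter_upwards [hgG] with x hx hxI
      rw [hx hxI]
  refine ⟨C, ?_⟩
  filter_upwards [hC] with x hx hxI
  linarith [hx hxI]

/-- A function on `(c, d)` whose weak derivative of order `m + 1` is bounded by `M` agrees almost
everywhere with a `C^m` function on the line whose `m`-th derivative has Lipschitz constant `M`. -/
theorem exists_contDiff_ae_eq (hcd : c < d) {M : ℝ} (m : ℕ) {u g : ℝ → ℝ}
    (hu : ∀ j ≤ m + 1, ∃ g, HasWeakDeriv j (Ioo c d) u g)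
    (hg : HasWeakDeriv (m + 1) (Ioo c d) u g) (hM : 0 ≤ M)
    (hgM : ∀ᵐ x, x ∈ Ioo c d → |g x| ≤ M) :
    ∃ U : ℝ → ℝ, ContDiff ℝ m U ∧
      (∀ x y, |iteratedDeriv m U x - iteratedDeriv m U y| ≤ M * |x - y|) ∧
      ∀ᵐ x, x ∈ Ioo c d → u x = U x := by
  induction m generalizing u with
  | zero =>
    have hbd : ∀ᵐ x, ‖(Ioo c d).indicator g x‖ ≤ M := by
      filter_upwards [hgM] with x hx
      by_cases hxI : x ∈ Ioo c d
      · rw [indicator_of_mem hxI]; exact hx hxI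
      · rw [indicator_of_notMem hxI, norm_zero]; exact hM
    have hgi : Integrable ((Ioo c d).indicator g) := by
      rw [integrable_indicator_iff measurableSet_Ioo]
      exact Integrable.of_bound hg.2.1.aestronglyMeasurable M
        ((ae_restrict_iff' measurableSet_Ioo).2 hgM)
    obtain ⟨C, hC⟩ := exists_ae_eq_primitive hcd hg hgi
      (Eventually.of_forall fun x hx => (indicator_of_mem hx g).symm)
    refine ⟨fun x => C + ∫ t in c..x, (Ioo c d).indicator g t, ?_, fun x y => ?_, hC⟩
    · exact contDiff_zero.2 (continuous_const.add
        (intervalIntegral.continuous_primitive (fun _ _ => hgi.intervalIntegrable) c))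
    · simp only [iteratedDeriv_zero, add_sub_add_left_eq_sub]
      rw [intervalIntegral.integral_interval_sub_left hgi.intervalIntegrable
        hgi.intervalIntegrable]
      exact intervalIntegral.norm_integral_le_of_norm_le_const_ae
        (hbd.mono fun x hx _ => hx)
  | succ m ih =>
    obtain ⟨g₁, hg₁⟩ := hu 1 (by omega)
    obtain ⟨U₁, hU₁, hLip, hae⟩ := ih (u := g₁)
      (fun j hj => by
        obtain ⟨gj, hgj⟩ := hu (j + 1) (by omega)
        exact ⟨gj, hg₁.of_succ hgj⟩) (hg₁.of_succ hg)
    have hcont : Continuous U₁ := hU₁.continuous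
    have hi : Integrable ((Ioo c d).indicator U₁) := by
      rw [integrable_indicator_iff measurableSet_Ioo]
      exact (hcont.integrableOn_Icc).mono_set Ioo_subset_Icc_self
    obtain ⟨C, hC⟩ := exists_ae_eq_primitive hcd hg₁ hi (by
      filter_upwards [hae] with x hx hxI
      rw [hx hxI, indicator_of_mem hxI])
    have hder : ∀ x, HasDerivAt (fun x => C + ∫ t in c..x, U₁ t) (U₁ x) x := fun x =>
      (intervalIntegral.integral_hasDerivAt_right (hcont.intervalIntegrable _ _)
        (hcont.stronglyMeasurableAtFilter _ _) hcont.continuousAt).const_add C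
    have hderiv : deriv (fun x => C + ∫ t in c..x, U₁ t) = U₁ := funext fun x => (hder x).deriv
    refine ⟨fun x => C + ∫ t in c..x, U₁ t, ?_, fun x y => ?_, ?_⟩
    · have : ((m + 1 : ℕ) : WithTop ℕ∞) = (m : WithTop ℕ∞) + 1 := by norm_cast
      rw [this, contDiff_succ_iff_deriv, hderiv]
      exact ⟨fun x => (hder x).differentiableAt, by simp, hU₁⟩
    · rw [iteratedDeriv_succ', hderiv]; exact hLip x y
    · filter_upwards [hC] with x hx hxI
      rw [hx hxI]
      congr 1
      refine intervalIntegral.integral_congr_ae ?_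
      filter_upwards with t ht
      rw [uIoc_of_le hxI.1.le] at ht
      have htI : t ∈ Ioo c d := ⟨ht.1, ht.2.trans_lt hxI.2⟩
      rw [indicator_of_mem htI]

theorem ae_abs_le_seminormInf {m : ℕ} {u : ℝ → ℝ} (hu : MemW m ∞ (Ioo c d) u) :
    HasWeakDeriv m (Ioo c d) u (weakDeriv m (Ioo c d) u) ∧
      ∀ᵐ x, x ∈ Ioo c d → |weakDeriv m (Ioo c d) u x| ≤ seminormInf m (Ioo c d) u := by
  obtain ⟨g, hg, hgL⟩ := hu m le_rfl
  have hex : ∃ g, HasWeakDeriv m (Ioo c d) u g := ⟨g, hg⟩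
  have hw : HasWeakDeriv m (Ioo c d) u (weakDeriv m (Ioo c d) u) := by
    unfold weakDeriv; rw [dif_pos hex]; exact hex.choose_spec
  refine ⟨hw, ?_⟩
  have hae : weakDeriv m (Ioo c d) u =ᵐ[volume.restrict (Ioo c d)] g :=
    (ae_restrict_iff' measurableSet_Ioo).2 (hw.ae_eq isOpen_Ioo hg)
  have hL : MemLp (weakDeriv m (Ioo c d) u) ∞ (volume.restrict (Ioo c d)) :=
    (memLp_congr_ae hae).2 hgL
  have hbd := ae_le_eLpNormEssSup (f := weakDeriv m (Ioo c d) u)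
    (μ := volume.restrict (Ioo c d))
  rw [ae_restrict_iff' measurableSet_Ioo] at hbd
  filter_upwards [hbd] with x hx hxI
  have h1 := hx hxI
  have h2 := hL.eLpNorm_lt_top
  rw [← eLpNorm_exponent_top] at h1
  have h3 := ENNReal.toReal_mono h2.ne h1
  simpa [seminormInf] using h3

/-- The classical representative of a continuous function in `W^{m+1,∞}`. -/
theorem MemW.exists_contDiff (hcd : c < d) {m : ℕ} {u : ℝ → ℝ}
    (hu : MemW (m + 1) ∞ (Ioo c d) u) (hc : ContinuousOn u (Icc c d)) :
    ∃ U : ℝ → ℝ, ContDiff ℝ m U ∧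
      (∀ x y, |iteratedDeriv m U x - iteratedDeriv m U y| ≤
        seminormInf (m + 1) (Ioo c d) u * |x - y|) ∧
      EqOn u U (Icc c d) := by
  obtain ⟨hw, hbd⟩ := ae_abs_le_seminormInf hu
  obtain ⟨U, hU, hLip, hae⟩ := exists_contDiff_ae_eq hcd m
    (fun j hj => (hu j hj).imp fun g hg => hg.1) hw ENNReal.toReal_nonneg hbd
  refine ⟨U, hU, hLip, ?_⟩
  have h1 : EqOn u U (Ioo c d) :=
    Measure.eqOn_open_of_ae_eq ((ae_restrict_iff' measurableSet_Ioo).2 hae) isOpen_Ioo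
      (hc.mono Ioo_subset_Icc_self) hU.continuous.continuousOn
  rw [← closure_Ioo hcd.ne] at hc ⊢
  exact h1.of_subset_closure hc hU.continuous.continuousOn subset_closure subset_rfl

end

/-! ### Taylor polynomials of functions with Lipschitz derivative -/

/-- The polynomial of degree at most `n` whose derivatives at `α` are `c 0, …, c n`. -/
def taylorPoly (n : ℕ) (α : ℝ) (c : ℕ → ℝ) : ℝ[X] :=
  ∑ j ∈ Finset.range (n + 1), C (c j / (j.factorial : ℝ)) * (X - C α) ^ j

theorem degree_taylorPoly_lt (n : ℕ) (α : ℝ) (c : ℕ → ℝ) :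
    (taylorPoly n α c).degree < ((n + 1 : ℕ) : WithBot ℕ) := by
  refine (degree_sum_le _ _).trans_lt ((Finset.sup_lt_iff (WithBot.bot_lt_coe _)).2 fun j hj => ?_)
  rw [← smul_eq_C_mul]
  refine (degree_smul_le _ _).trans_lt ?_
  rw [degree_pow, degree_X_sub_C, nsmul_one]
  exact_mod_cast Finset.mem_range.1 hj

theorem eval_taylorPoly (n : ℕ) (α : ℝ) (c : ℕ → ℝ) (x : ℝ) :
    (taylorPoly n α c).eval x =
      ∑ j ∈ Finset.range (n + 1), c j / (j.factorial : ℝ) * (x - α) ^ j := by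
  simp [taylorPoly, eval_finsetSum]

theorem derivative_taylorPoly (n : ℕ) (α : ℝ) (c : ℕ → ℝ) :
    derivative (taylorPoly (n + 1) α c) = taylorPoly n α fun j => c (j + 1) := by
  rw [taylorPoly, Finset.sum_range_succ', derivative_add, derivative_sum, taylorPoly]
  simp only [pow_zero, mul_one, derivative_C, add_zero]
  refine Finset.sum_congr rfl fun j _ => ?_
  rw [derivative_C_mul, derivative_X_sub_C_pow, ← mul_assoc, ← C_mul, Nat.add_sub_cancel]
  congr 2
  rw [Nat.factorial_succ]
  push_cast
  field_simp

theorem abs_sub_taylorPoly_le (n : ℕ) {F : ℝ → ℝ} {M α : ℝ} {c : ℕ → ℝ} (hM : 0 ≤ M)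
    (hF : ContDiff ℝ n F)
    (hLip : ∀ x y, |iteratedDeriv n F x - iteratedDeriv n F y| ≤ M * |x - y|)
    (hc : ∀ j ≤ n, iteratedDeriv j F α = c j) (x : ℝ) :
    |F x - (taylorPoly n α c).eval x| ≤ M * |x - α| ^ (n + 1) := by
  induction n generalizing F c x with
  | zero =>
    have h := hLip x α
    have h0 := hc 0 le_rfl
    simp only [iteratedDeriv_zero] at h h0
    simpa [eval_taylorPoly, ← h0] using h
  | succ n ih =>
    have e : ((n + 1 : ℕ) : WithTop ℕ∞) = (n : WithTop ℕ∞) + 1 := by norm_cast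
    rw [e, contDiff_succ_iff_deriv] at hF
    have h1 := ih (F := deriv F) (c := fun j => c (j + 1)) hF.2.2
      (fun x y => by simpa only [iteratedDeriv_succ'] using hLip x y)
      (fun j hj => by rw [← iteratedDeriv_succ']; exact hc (j + 1) (by omega))
    have hder : ∀ y ∈ uIcc α x, HasDerivWithinAt
        (fun y => F y - (taylorPoly (n + 1) α c).eval y)
        (deriv F y - (taylorPoly n α fun j => c (j + 1)).eval y) (uIcc α x) y := fun y _ => by
      rw [← derivative_taylorPoly]
      exact ((hF.1 y).hasDerivAt.sub (Polynomial.hasDerivAt _ y)).hasDerivWithinAt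
    have hbd : ∀ y ∈ uIcc α x, ‖deriv F y - (taylorPoly n α fun j => c (j + 1)).eval y‖ ≤
        M * |x - α| ^ (n + 1) := fun y hy => by
      refine (h1 y).trans (mul_le_mul_of_nonneg_left ?_ hM)
      exact pow_le_pow_left₀ (abs_nonneg _) (abs_sub_left_of_mem_uIcc hy) _
    have key := (convex_uIcc α x).norm_image_sub_le_of_norm_hasDerivWithin_le hder hbd
      left_mem_uIcc right_mem_uIcc
    have h0 : F α - (taylorPoly (n + 1) α c).eval α = 0 := by
      have := hc 0 (by omega)
      rw [iteratedDeriv_zero] at this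
      rw [eval_taylorPoly, Finset.sum_range_succ']
      simp [this]
    simp only [h0, sub_zero] at key
    rw [pow_succ, ← mul_assoc]
    exact key

/-! ### Fluxes and the generalized Lobatto expansion on one element -/

/-- `G` is the flux of `u` on `(x0, x1)`: a continuous function with `u' = w G` off the point `s`,
where `w` is the reciprocal of the diffusion coefficient. -/
structure IsFlux (w : ℝ → ℝ) (s x0 x1 : ℝ) (u G : ℝ → ℝ) : Prop where
  continuousOn : ContinuousOn u (Icc x0 x1)
  continuous : Continuous G
  hasDerivAt : ∀ x ∈ Ioo x0 x1, x ≠ s → HasDerivAt u (w x * G x) x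

section Flux

variable {w : ℝ → ℝ} {lo hi s x0 x1 : ℝ} {u v G H : ℝ → ℝ}

theorem IsFlux.mono (h : IsFlux w s x0 x1 u G) {y0 y1 : ℝ} (h0 : x0 ≤ y0) (h1 : y1 ≤ x1) :
    IsFlux w s y0 y1 u G :=
  ⟨h.continuousOn.mono (Icc_subset_Icc h0 h1), h.continuous,
    fun x hx => h.hasDerivAt x (Ioo_subset_Ioo h0 h1 hx)⟩

theorem IsFlux.sub (hu : IsFlux w s x0 x1 u G) (hv : IsFlux w s x0 x1 v H) :
    IsFlux w s x0 x1 (fun x => u x - v x) (fun x => G x - H x) :=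
  ⟨hu.continuousOn.sub hv.continuousOn, hu.continuous.sub hv.continuous, fun x hx hxs => by
    rw [mul_sub]; exact (hu.hasDerivAt x hx hxs).sub (hv.hasDerivAt x hx hxs)⟩

theorem IsFlux.integral_eq (hw : IsWeight w lo hi) (h : IsFlux w s x0 x1 u G) {x : ℝ}
    (hx : x ∈ Icc x0 x1) : ∫ t in x0..x, w t * G t = u x - u x0 := by
  refine integral_eq_of_hasDerivAt_off_countable_of_le u _ hx.1 (countable_singleton s)
    (h.continuousOn.mono (Icc_subset_Icc_right hx.2)) (fun y hy => ?_) (hw.integrable h.continuous _ _)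
  exact h.hasDerivAt y ⟨hy.1.1, hy.1.2.trans_le hx.2⟩ hy.2

theorem IsFlux.piecewiseDiff (hw : IsWeight w lo hi) (h : IsFlux w s x0 x1 u G) :
    PiecewiseDiff x0 x1 u := by
  obtain ⟨B, hB⟩ := (isCompact_Icc (a := x0) (b := x1)).exists_bound_of_continuousOn
    h.continuous.continuousOn
  refine ⟨h.continuousOn, {s}, hi * B, finite_singleton s, fun x hx hxs => ?_⟩
  have hd := h.hasDerivAt x hx hxs
  refine ⟨hd.differentiableAt, ?_⟩
  rw [hd.deriv, abs_mul, abs_of_pos (hw.pos x)]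
  exact mul_le_mul (hw.le_hi x) (hB x (Ioo_subset_Icc_self hx)) (abs_nonneg _) hw.hi_pos.le

theorem integral_congr_off_singleton (h01 : x0 ≤ x1) {f g : ℝ → ℝ}
    (hfg : ∀ x ∈ Ioo x0 x1, x ≠ s → f x = g x) : ∫ x in x0..x1, f x = ∫ x in x0..x1, g x := by
  refine intervalIntegral.integral_congr_ae ?_
  filter_upwards [ae_notMem_of_finite ((finite_singleton s).insert x1) volume] with x hx hxI
  rw [uIoc_of_le h01] at hxI
  simp only [mem_insert_iff, mem_singleton_iff, not_or] at hx
  exact hfg x ⟨hxI.1, hxI.2.lt_of_ne hx.1⟩ hx.2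

/-- A family of (generalized) Lobatto functions `φ n` on `[x0, x1]`: the functions `φ 0`, `φ 1` have
constant flux and are nodal at the end points, and for `n ≥ 2` the flux of `φ n` is a multiple of
the orthogonal polynomial `Q (n - 1)`. With truncated subtraction the constant fluxes of `φ 0` and
`φ 1` are multiples of `Q 0`. -/
structure IsLobattoFamily (w : ℝ → ℝ) (s x0 x1 : ℝ) (φ : ℕ → ℝ → ℝ) (Q : ℕ → ℝ[X]) : Prop where
  continuous : ∀ n, Continuous (φ n)
  ortho : ∀ n, IsOrthoPoly w x0 x1 n (Q n)
  hasDerivAt : ∀ n, ∃ c : ℝ, (2 ≤ n → c ≠ 0) ∧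
    ∀ x, x ≠ s → HasDerivAt (φ n) (w x * (c * (Q (n - 1)).eval x)) x
  left : ∀ n, φ n x0 = if n = 0 then 1 else 0
  right : ∀ n, φ n x1 = if n = 1 then 1 else 0

variable {φ : ℕ → ℝ → ℝ} {Q : ℕ → ℝ[X]}

theorem IsOrthoPoly.ip_eq_zero {n m : ℕ} {P R : ℝ[X]} (hP : IsOrthoPoly w x0 x1 n P)
    (hR : IsOrthoPoly w x0 x1 m R) (hnm : n ≠ m) :
    ip w x0 x1 (fun x => P.eval x) (fun x => R.eval x) = 0 := by
  rcases hnm.lt_or_gt with h | h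
  · rw [ip_comm]; exact hR.ortho P (by rw [hP.degree_eq]; exact_mod_cast h)
  · exact hP.ortho R (by rw [hR.degree_eq]; exact_mod_cast h)

theorem ip_sum_left (hw : IsWeight w lo hi) {ι : Type*} (t : Finset ι) (P : ι → ℝ[X]) (e : ι → ℝ)
    {h : ℝ → ℝ} (hh : Continuous h) :
    ip w x0 x1 (fun x => (∑ n ∈ t, C (e n) * P n).eval x) h =
      ∑ n ∈ t, e n * ip w x0 x1 (fun x => (P n).eval x) h := by
  classical
  induction t using Finset.induction_on with
  | empty => simp [ip]
  | insert n t hn ih =>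
    simp only [Finset.sum_insert hn, eval_add]
    rw [ip_add_left hw (by fun_prop) (by fun_prop) hh, ih]
    simp only [eval_mul, eval_C]
    rw [ip_const_mul_left]

/-- `I` approximates `u` on an element by interpolation at the end points and by projection of the
flux: the flux `q` of `I` is the weighted `L²` projection of the flux `G` of `u` onto polynomials of
degree less than `p`. Up to `ε`, the flux error is a multiple of `P`; at the roots of `φ` the error
itself is bounded by `ε'`. -/
structure IsLobattoApprox (w : ℝ → ℝ) (s x0 x1 : ℝ) (p : ℕ) (ε ε' : ℝ) (u G φ : ℝ → ℝ) (P : ℝ[X])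
    (I : ℝ → ℝ) (q : ℝ[X]) : Prop where
  degree_lt : q.degree < p
  isFlux : IsFlux w s x0 x1 I (fun x => q.eval x)
  left : I x0 = u x0
  right : I x1 = u x1
  ortho : ∀ r : ℝ[X], r.degree < p →
    ip w x0 x1 (fun x => G x - q.eval x) (fun x => r.eval x) = 0
  flux_error : ∃ c : ℝ, ∀ x ∈ Icc x0 x1, |G x - q.eval x - c * P.eval x| ≤ ε
  error : ∀ x ∈ Icc x0 x1, φ x = 0 → |u x - I x| ≤ ε'

/-- Error of the Lobatto interpolant `∑ γ n φ n` of `u` on one element. Orthogonality of the flux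
error to constants is interpolation at the end points, and orthogonality to the other `Q n` is the
choice of `γ`. Hence the flux error is a multiple of `Q p` up to higher order, and the primitive of
that multiple is a multiple of `φ (p + 1)`. -/
theorem IsLobattoFamily.exists_isLobattoApprox (hw : IsWeight w lo hi) (h01 : x0 < x1)
    (hφ : IsLobattoFamily w s x0 x1 φ Q) (hu : IsFlux w s x0 x1 u G) {p : ℕ} (hp : 1 ≤ p)
    {γ : ℕ → ℝ} (hγ0 : γ 0 = u x0) (hγ1 : γ 1 = u x1)
    (hγ : ∀ n, γ (n + 2) = (∫ x in x0..x1, (w x)⁻¹ * deriv u x * deriv (φ (n + 2)) x) /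
      ∫ x in x0..x1, (w x)⁻¹ * deriv (φ (n + 2)) x * deriv (φ (n + 2)) x)
    {T : ℝ[X]} (hT : T.degree < ((p + 1 : ℕ) : WithBot ℕ)) {δ : ℝ}
    (hGT : ∀ x ∈ Icc x0 x1, |G x - T.eval x| ≤ δ)
    {I : ℝ → ℝ} (hI : ∀ x, I x = ∑ n ∈ Finset.range (p + 1), γ n * φ n x) :
    ∃ q : ℝ[X], IsLobattoApprox w s x0 x1 p (stab p (hi / lo) * δ)
      (hi * (x1 - x0) * (stab p (hi / lo) * δ)) u G (φ (p + 1)) (Q p) I q := by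
  choose κ hκ0 hκ using hφ.hasDerivAt
  set q : ℝ[X] := ∑ n ∈ Finset.range (p + 1), C (γ n * κ n) * Q (n - 1) with hq
  have hqd : q.degree < p := by
    refine (degree_sum_le _ _).trans_lt ((Finset.sup_lt_iff (WithBot.bot_lt_coe _)).2 fun j hj => ?_)
    rw [← smul_eq_C_mul]
    refine (degree_smul_le _ _).trans_lt ?_
    rw [(hφ.ortho _).degree_eq]
    have := Finset.mem_range.1 hj
    norm_cast; omega
  have hIfun : I = fun x => ∑ n ∈ Finset.range (p + 1), γ n * φ n x := funext hI
  have hIq : IsFlux w s x0 x1 I (fun x => q.eval x) := by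
    refine ⟨?_, by fun_prop, fun x _ hxs => ?_⟩
    · rw [hIfun]
      exact (continuous_finsetSum _ fun n _ => continuous_const.mul
        (hφ.continuous n)).continuousOn
    · have := HasDerivAt.fun_sum (u := Finset.range (p + 1))
        fun n _ => (hκ n x hxs).const_mul (γ n)
      rw [hIfun]
      refine this.congr_deriv ?_
      rw [hq, eval_finsetSum, Finset.mul_sum]
      refine Finset.sum_congr rfl fun n _ => ?_
      rw [eval_mul, eval_C]; ring
  have hI0 : I x0 = u x0 := by
    rw [hI, ← hγ0]; simp [hφ.left]
  have hI1 : I x1 = u x1 := by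
    rw [hI, ← hγ1]
    simp only [hφ.right, mul_ite, mul_one, mul_zero, Finset.sum_ite_eq', Finset.mem_range]
    rw [if_pos (by omega)]
  have hsub := hu.sub hIq
  have hGc := hu.continuous
  have horth : ∀ r : ℝ[X], r.degree < p →
      ip w x0 x1 (fun x => G x - q.eval x) (fun x => r.eval x) = 0 := by
    let S : Submodule ℝ ℝ[X] :=
      { carrier := {r | ip w x0 x1 (fun x => G x - q.eval x) (fun x => r.eval x) = 0}
        add_mem' := by
          intro r t hr ht
          simp only [mem_ofPred_eq, eval_add] at hr ht ⊢
          rw [ip_add_right hw (by fun_prop) (by fun_prop) (by fun_prop), hr, ht, add_zero]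
        zero_mem' := by simp [ip]
        smul_mem' := by
          intro c r hr
          simp only [mem_ofPred_eq, eval_smul, smul_eq_mul] at hr ⊢
          rw [ip_const_mul_right, hr, mul_zero] }
    intro r hr
    refine mem_of_degree_lt (S := S) (fun j _ => (hφ.ortho j).degree_eq) (fun j hj => ?_) hr
    change ip w x0 x1 (fun x => G x - q.eval x) (fun x => (Q j).eval x) = 0
    match j with
    | 0 =>
      have h0 : (Q 0).natDegree = 0 := natDegree_eq_of_degree_eq_some (hφ.ortho 0).degree_eq
      obtain ⟨e, he⟩ := natDegree_eq_zero.1 h0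
      have h1 := hsub.integral_eq hw (right_mem_Icc.2 h01.le)
      rw [hI0, hI1, sub_self, sub_self, sub_self] at h1
      rw [ip_comm, ← he]
      simp only [eval_C, ip]
      have : (fun x => w x * (e * (G x - q.eval x))) = fun x => e * (w x * (G x - q.eval x)) := by
        ext x; ring
      rw [this, intervalIntegral.integral_const_mul, h1, mul_zero]
    | m + 1 =>
      have hk : κ (m + 2) ≠ 0 := hκ0 (m + 2) (by omega)
      have hQQ := ip_self_pos hw h01 (hφ.ortho (m + 1)).ne_zero
      have e1 : ∫ x in x0..x1, (w x)⁻¹ * deriv u x * deriv (φ (m + 2)) x =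
          κ (m + 2) * ip w x0 x1 G (fun x => (Q (m + 1)).eval x) := by
        rw [← ip_const_mul_right]
        refine integral_congr_off_singleton (s := s) h01.le fun x hx hxs => ?_
        rw [(hu.hasDerivAt x hx hxs).deriv, (hκ (m + 2) x hxs).deriv]
        have := (hw.pos x).ne'
        simp only [Nat.add_one_sub_one]
        field_simp
      have e2 : ∫ x in x0..x1, (w x)⁻¹ * deriv (φ (m + 2)) x * deriv (φ (m + 2)) x =
          κ (m + 2) * (κ (m + 2) * ip w x0 x1 (fun x => (Q (m + 1)).eval x)
            (fun x => (Q (m + 1)).eval x)) := by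
        rw [← ip_const_mul_right, ← ip_const_mul_left]
        refine integral_congr_off_singleton (s := s) h01.le fun x hx hxs => ?_
        rw [(hκ (m + 2) x hxs).deriv]
        have := (hw.pos x).ne'
        simp only [Nat.add_one_sub_one]
        field_simp
      have e3 : ip w x0 x1 (fun x => q.eval x) (fun x => (Q (m + 1)).eval x) =
          γ (m + 2) * κ (m + 2) * ip w x0 x1 (fun x => (Q (m + 1)).eval x)
            (fun x => (Q (m + 1)).eval x) := by
        rw [hq, ip_sum_left hw _ _ _ (by fun_prop), Finset.sum_eq_single (m + 2)]
        · rfl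
        · intro n _ hn
          rw [(hφ.ortho (n - 1)).ip_eq_zero (hφ.ortho (m + 1)) (by omega), mul_zero]
        · intro hn; exact absurd (Finset.mem_range.2 (by omega)) hn
      rw [ip_sub_left hw (by fun_prop) (by fun_prop) (by fun_prop), e3, hγ m, e1, e2]
      field_simp; ring
  obtain ⟨c, hc⟩ := exists_abs_sub_le_of_ortho hw h01 (hφ.ortho p) hqd hGc horth hT hGT
  refine ⟨q, hqd, hIq, hI0, hI1, horth, ⟨c, hc⟩, fun x hx hx0 => ?_⟩
  have hφf : IsFlux w s x0 x1 (φ (p + 1)) (fun x => κ (p + 1) * (Q p).eval x) :=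
    ⟨(hφ.continuous _).continuousOn, by fun_prop, fun y _ hys => hκ (p + 1) y hys⟩
  -- the primitive of `w Q p` vanishes at the roots of `φ (p + 1)`
  have hQ0 : ∫ t in x0..x, w t * (Q p).eval t = 0 := by
    have h1 := hφf.integral_eq hw hx
    have h2 : (fun t => w t * (κ (p + 1) * (Q p).eval t)) =
        fun t => κ (p + 1) * (w t * (Q p).eval t) := by ext t; ring
    rw [hx0, hφ.left, if_neg (by omega), sub_self, h2, intervalIntegral.integral_const_mul] at h1
    exact (mul_eq_zero.1 h1).resolve_left (hκ0 _ (by omega))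
  have h1 := hsub.integral_eq hw hx
  rw [hI0, sub_self, sub_zero] at h1
  have h2 : ∫ t in x0..x, w t * (G t - q.eval t - c * (Q p).eval t) = u x - I x := by
    have : (fun t => w t * (G t - q.eval t - c * (Q p).eval t)) =
        fun t => w t * (G t - q.eval t) - c * (w t * (Q p).eval t) := by ext t; ring
    rw [this, intervalIntegral.integral_sub (hw.integrable (by fun_prop) _ _)
      ((hw.integrable (by fun_prop) _ _).const_mul c), intervalIntegral.integral_const_mul, hQ0,
      h1, mul_zero, sub_zero]
  have hδ : 0 ≤ δ := (abs_nonneg _).trans (hGT x0 (left_mem_Icc.2 h01.le))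
  have hsd : 0 ≤ stab p (hi / lo) * δ := mul_nonneg (stab_nonneg _ _) hδ
  rw [← h2]
  have h3 := intervalIntegral.norm_integral_le_of_norm_le_const (a := x0) (b := x)
    (f := fun t => w t * (G t - q.eval t - c * (Q p).eval t))
    (C := hi * (stab p (hi / lo) * δ)) fun t ht => by
      rw [uIoc_of_le hx.1] at ht
      rw [Real.norm_eq_abs, abs_mul, abs_of_pos (hw.pos t)]
      exact mul_le_mul (hw.le_hi t) (hc t ⟨ht.1.le, ht.2.trans hx.2⟩) (abs_nonneg _) hw.hi_pos.le
  refine h3.trans ?_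
  rw [abs_of_nonneg (sub_nonneg.2 hx.1)]
  have h4 : x - x0 ≤ x1 - x0 := by linarith [hx.2]
  have h5 := mul_le_mul_of_nonneg_left h4 (mul_nonneg hw.hi_pos.le hsd)
  linarith

end Flux

/-! ### The Lobatto and the generalized Lobatto functions -/

theorem integral_legendre_eq_zero (n : ℕ) : ∫ t in (-1 : ℝ)..1, (legendre (n + 1)).eval t = 0 := by
  have h := (legendre_isOrthoPoly (n + 1)).ortho 1 (by rw [degree_one]; exact_mod_cast n.succ_pos)
  simpa [ip] using h

theorem integral_genLegendre_eq_zero {βm βp : ℝ} (hm : 0 < βm) (hp : 0 < βp) (s : ℝ) (n : ℕ) :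
    ∫ t in (-1 : ℝ)..1, (coeff βm βp s t)⁻¹ * (genLegendre βm βp s (n + 1)).eval t = 0 := by
  have h := (genLegendre_isOrthoPoly hm hp s (n + 1)).1.ortho 1
    (by rw [degree_one]; exact_mod_cast n.succ_pos)
  simpa [ip] using h

theorem lobatto_isLobattoFamily (s : ℝ) :
    IsLobattoFamily (fun _ => 1) s (-1) 1 lobatto legendre := by
  have hP0 : ∀ x, (legendre 0).eval x = 1 := fun x => by simp [legendre]
  have hder : ∀ n, ∃ c : ℝ, (2 ≤ n → c ≠ 0) ∧
      ∀ x, HasDerivAt (lobatto n) (1 * (c * (legendre (n - 1)).eval x)) x := by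
    intro n
    match n with
    | 0 =>
      refine ⟨-1 / 2, by simp, fun x => ?_⟩
      rw [hP0]
      exact (((hasDerivAt_id x).const_sub 1).div_const 2).congr_deriv (by ring)
    | 1 =>
      refine ⟨1 / 2, by simp, fun x => ?_⟩
      rw [hP0]
      exact (((hasDerivAt_id x).const_add 1).div_const 2).congr_deriv (by ring)
    | n + 2 =>
      refine ⟨1, fun _ => one_ne_zero, fun x => ?_⟩
      rw [one_mul, one_mul]
      have hc : Continuous fun t => (legendre (n + 1)).eval t := by fun_prop
      exact intervalIntegral.integral_hasDerivAt_right (hc.intervalIntegrable _ _)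
        (hc.stronglyMeasurableAtFilter _ _) hc.continuousAt
  refine ⟨fun n => ?_, legendre_isOrthoPoly, fun n => ?_, fun n => ?_, fun n => ?_⟩
  · obtain ⟨c, _, h⟩ := hder n
    exact continuous_iff_continuousAt.2 fun x => (h x).continuousAt
  · obtain ⟨c, hc, h⟩ := hder n
    exact ⟨c, hc, fun x _ => h x⟩
  · match n with
    | 0 => norm_num [lobatto]
    | 1 => norm_num [lobatto]
    | n + 2 => simp [lobatto]
  · match n with
    | 0 => norm_num [lobatto]
    | 1 => norm_num [lobatto]
    | n + 2 => simp [lobatto, integral_legendre_eq_zero]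

theorem coeff_eventuallyEq {βm βp s x : ℝ} (hx : x ≠ s) :
    ∀ᶠ y in 𝓝 x, coeff βm βp s y = coeff βm βp s x := by
  rcases hx.lt_or_gt with h | h
  · filter_upwards [Iio_mem_nhds h] with y hy
    have hy' : y < s := hy
    simp [coeff, h, hy']
  · filter_upwards [Ioi_mem_nhds h] with y hy
    have hy' : s < y := hy
    simp [coeff, h.not_gt, hy'.not_gt]

theorem hasDerivAt_ite {s A A' B B' x : ℝ} (hx : x ≠ s) :
    HasDerivAt (fun ξ => if ξ < s then A + A' * ξ else B + B' * ξ) (if x < s then A' else B') x := by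
  have haff : ∀ D D' : ℝ, HasDerivAt (fun ξ => D + D' * ξ) D' x := fun D D' => by
    simpa using ((hasDerivAt_id x).const_mul D').const_add D
  rcases hx.lt_or_gt with h | h
  · rw [if_pos h]
    refine (haff A A').congr_of_eventuallyEq ?_
    filter_upwards [Iio_mem_nhds h] with y hy
    exact if_pos hy
  · rw [if_neg h.not_gt]
    refine (haff B B').congr_of_eventuallyEq ?_
    filter_upwards [Ioi_mem_nhds h] with y hy
    exact if_neg (not_lt.2 (le_of_lt hy))

theorem continuous_ite_affine {s A A' B B' : ℝ} (h : A + A' * s = B + B' * s) :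
    Continuous fun ξ : ℝ => if ξ < s then A + A' * ξ else B + B' * ξ := by
  have e : (fun ξ : ℝ => if ξ < s then A + A' * ξ else B + B' * ξ) =
      fun ξ => if s ≤ ξ then B + B' * ξ else A + A' * ξ := by
    ext ξ
    by_cases hξ : ξ < s
    · rw [if_pos hξ, if_neg (not_le.2 hξ)]
    · rw [if_neg hξ, if_pos (not_lt.1 hξ)]
  rw [e]
  refine Continuous.if_le (by fun_prop) (by fun_prop) (by fun_prop) (by fun_prop) ?_
  rintro x rfl
  exact h.symm

theorem genLobatto_isLobattoFamily {βm βp s : ℝ} (hm : 0 < βm) (hp : 0 < βp) (hs : s ∈ Icc (-1) 1) :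
    IsLobattoFamily (fun x => (coeff βm βp s x)⁻¹) s (-1) 1 (genLobatto βm βp s)
      (genLegendre βm βp s) := by
  have hw := isWeight_coeff_inv hm hp s
  obtain ⟨D, hD⟩ : ∃ D, D = (1 - s) * βm + (1 + s) * βp := ⟨_, rfl⟩
  have hD0 : 0 < D := by
    rw [hD]
    rcases hs.1.eq_or_lt with rfl | h
    · nlinarith
    · nlinarith [mul_nonneg (sub_nonneg.2 hs.2) hm.le, mul_pos (by linarith : 0 < 1 + s) hp]
  have hP0 : ∀ x, (genLegendre βm βp s 0).eval x = 1 := fun x => by simp [genLegendre]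
  have e0 : genLobatto βm βp s 0 = fun ξ =>
      if ξ < s then ((1 - s) * βm + s * βp) / D + (-βp / D) * ξ else βm / D + (-βm / D) * ξ := by
    ext ξ
    simp only [genLobatto, ← hD]
    split_ifs <;> ring
  have e1 : genLobatto βm βp s 1 = fun ξ =>
      if ξ < s then βp / D + (βp / D) * ξ else (-s * βm + (1 + s) * βp) / D + (βm / D) * ξ := by
    ext ξ
    simp only [genLobatto, ← hD]
    split_ifs <;> ring
  have e2 : ∀ n, genLobatto βm βp s (n + 2) = fun ξ => ∫ t in (-1 : ℝ)..ξ,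
      (coeff βm βp s t)⁻¹ * (genLegendre βm βp s (n + 1)).eval t := fun n => by
    ext ξ; simp only [genLobatto]
  refine ⟨fun n => ?_, fun n => (genLegendre_isOrthoPoly hm hp s n).1, fun n => ?_, fun n => ?_,
    fun n => ?_⟩
  · match n with
    | 0 => rw [e0]; exact continuous_ite_affine (by field_simp; ring)
    | 1 => rw [e1]; exact continuous_ite_affine (by field_simp; ring)
    | n + 2 =>
      rw [e2]
      exact intervalIntegral.continuous_primitive
        (fun a b => hw.integrable (by fun_prop) a b) (-1)
  · match n with
    | 0 =>
      refine ⟨-(βm * βp) / D, by simp, fun x hx => ?_⟩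
      rw [hP0, e0]
      refine (hasDerivAt_ite hx).congr_deriv ?_
      unfold coeff
      split_ifs <;> field_simp
    | 1 =>
      refine ⟨(βm * βp) / D, by simp, fun x hx => ?_⟩
      rw [hP0, e1]
      refine (hasDerivAt_ite hx).congr_deriv ?_
      unfold coeff
      split_ifs <;> field_simp
    | n + 2 =>
      refine ⟨1, fun _ => one_ne_zero, fun x hx => ?_⟩
      rw [one_mul, e2]
      refine intervalIntegral.integral_hasDerivAt_right (hw.integrable (by fun_prop) _ _)
        ?_ ?_
      · exact (hw.measurable.mul (by fun_prop :
          Continuous fun t => (genLegendre βm βp s (n + 1)).eval t).measurable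
          ).aestronglyMeasurable.stronglyMeasurableAtFilter
      · refine ContinuousAt.mul ?_ (by fun_prop)
        refine (continuousAt_const (y := (coeff βm βp s x)⁻¹)).congr ?_
        filter_upwards [coeff_eventuallyEq (βm := βm) (βp := βp) hx] with y hy
        rw [hy]
  · match n with
    | 0 =>
      rw [e0]
      rcases hs.1.eq_or_lt with h | h
      · subst h
        simp only [lt_irrefl, if_false, if_true]
        field_simp
        rw [hD]; ring
      · simp only [if_pos h, if_true]
        field_simp
        rw [hD]; ring
    | 1 =>
      rw [e1]
      rcases hs.1.eq_or_lt with h | h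
      · subst h
        simp only [lt_irrefl, if_false]
        norm_num
      · simp only [if_pos h]
        norm_num
    | n + 2 => simp [e2]
  · have h1 : ¬ (1 < s) := not_lt.2 hs.2
    match n with
    | 0 => rw [e0]; simp only [if_neg h1, zero_ne_one, if_false]; ring
    | 1 =>
      rw [e1]
      simp only [if_neg h1, if_true]
      field_simp
      rw [hD]; ring
    | n + 2 => simp [e2, integral_genLegendre_eq_zero hm hp]

/-- Transport of a Lobatto family from `[-1, 1]` to `[x0, x1]`. -/
theorem IsLobattoFamily.comp_affine {w v : ℝ → ℝ} {s t x0 x1 : ℝ} {φ : ℕ → ℝ → ℝ} {Q : ℕ → ℝ[X]}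
    (h01 : x0 < x1) (h : IsLobattoFamily w t (-1) 1 φ Q)
    (hv : ∀ x, v x = w ((2 * x - x0 - x1) / (x1 - x0)))
    (hst : ∀ x, x ≠ s → (2 * x - x0 - x1) / (x1 - x0) ≠ t) :
    IsLobattoFamily v s x0 x1 (fun n x => φ n ((2 * x - x0 - x1) / (x1 - x0)))
      (fun n => (Q n).comp (C (2 / (x1 - x0)) * X + C (-(x0 + x1) / (x1 - x0)))) := by
  have hh : x1 - x0 ≠ 0 := (sub_pos.2 h01).ne'
  have e2 : ∀ x, 2 / (x1 - x0) * x + -(x0 + x1) / (x1 - x0) = (2 * x - x0 - x1) / (x1 - x0) := by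
    intro x; field_simp; ring
  refine ⟨fun n => (h.continuous n).comp (by fun_prop), fun n => (h.ortho n).comp_affine h01 hv,
    fun n => ?_, fun n => ?_, fun n => ?_⟩
  · obtain ⟨c, hc, hd⟩ := h.hasDerivAt n
    refine ⟨c * (2 / (x1 - x0)), fun hn => mul_ne_zero (hc hn) (div_ne_zero two_ne_zero hh),
      fun x hx => ?_⟩
    have h1 : HasDerivAt (fun x => (2 * x - x0 - x1) / (x1 - x0)) (2 / (x1 - x0)) x := by
      simpa using ((((hasDerivAt_id x).const_mul 2).sub_const x0).sub_const x1).div_const (x1 - x0)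
    refine ((hd _ (hst x hx)).comp x h1).congr_deriv ?_
    simp only [eval_comp, eval_add, eval_mul, eval_C, eval_X, e2, hv]
    ring
  · have : (2 * x0 - x0 - x1) / (x1 - x0) = -1 := by field_simp; ring
    simp only [this, h.left]
  · have : (2 * x1 - x0 - x1) / (x1 - x0) = 1 := by field_simp; ring
    simp only [this, h.right]

/-! ### The solution on both sides of the interface -/

/-- `Um` and `Up` represent `u` on the two sides of the interface by functions on the line of class
`C^{m+1}` whose derivatives of order `m + 1` have Lipschitz constant `M`; the fluxes and their
derivatives up to order `m` match at the interface. -/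
structure IsSmoothRep (βm βp a α b M : ℝ) (m : ℕ) (u Um Up : ℝ → ℝ) : Prop where
  nonneg : 0 ≤ M
  contDiff_left : ContDiff ℝ ((m + 1 : ℕ) : WithTop ℕ∞) Um
  contDiff_right : ContDiff ℝ ((m + 1 : ℕ) : WithTop ℕ∞) Up
  lip_left : ∀ x y, |iteratedDeriv (m + 1) Um x - iteratedDeriv (m + 1) Um y| ≤ M * |x - y|
  lip_right : ∀ x y, |iteratedDeriv (m + 1) Up x - iteratedDeriv (m + 1) Up y| ≤ M * |x - y|
  eqOn_left : EqOn u Um (Icc a α)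
  eqOn_right : EqOn u Up (Icc α b)
  jump : ∀ j ≤ m, βm * iteratedDeriv (j + 1) Um α = βp * iteratedDeriv (j + 1) Up α

theorem eventuallyEq_of_eqOn_Icc {u U : ℝ → ℝ} {c d x : ℝ} (h : EqOn u U (Icc c d))
    (hx : x ∈ Ioo c d) : u =ᶠ[𝓝 x] U := by
  filter_upwards [Icc_mem_nhds hx.1 hx.2] with y hy using h hy

theorem MemWTilde.exists_isSmoothRep {βm βp a α b : ℝ} (haα : a < α) (hαb : α < b) {m : ℕ}
    {u : ℝ → ℝ} (hu : MemWTilde (m + 2) ∞ βm βp a α b u) :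
    ∃ Um Up, IsSmoothRep βm βp a α b (brokenSeminormInf (m + 2) a α b u) m u Um Up := by
  obtain ⟨Um, hUm, hLm, hem⟩ := hu.left.exists_contDiff haα
    (hu.continuousOn.mono (Icc_subset_Icc_right hαb.le))
  obtain ⟨Up, hUp, hLp, hep⟩ := hu.right.exists_contDiff hαb
    (hu.continuousOn.mono (Icc_subset_Icc_left haα.le))
  refine ⟨Um, Up, le_max_of_le_left ENNReal.toReal_nonneg, hUm, hUp,
    fun x y => (hLm x y).trans (mul_le_mul_of_nonneg_right (le_max_left _ _) (abs_nonneg _)),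
    fun x y => (hLp x y).trans (mul_le_mul_of_nonneg_right (le_max_right _ _) (abs_nonneg _)),
    hem, hep, fun j hj => ?_⟩
  obtain ⟨l, hl, hr⟩ := hu.jump (j + 1) (by omega) (by omega)
  have h1 : Tendsto (fun x => coeff βm βp α x * iteratedDeriv (j + 1) u x) (𝓝[<] α)
      (𝓝 (βm * iteratedDeriv (j + 1) Um α)) := by
    have hc : Continuous (iteratedDeriv (j + 1) Um) :=
      hUm.continuous_iteratedDeriv (j + 1) (by exact_mod_cast Nat.succ_le_succ hj)
    refine ((hc.const_mul βm).tendsto α |>.mono_left nhdsWithin_le_nhds).congr' ?_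
    filter_upwards [Ioo_mem_nhdsLT haα] with x hx
    rw [(eventuallyEq_of_eqOn_Icc hem hx).iteratedDeriv_eq, coeff, if_pos hx.2]
  have h2 : Tendsto (fun x => coeff βm βp α x * iteratedDeriv (j + 1) u x) (𝓝[>] α)
      (𝓝 (βp * iteratedDeriv (j + 1) Up α)) := by
    have hc : Continuous (iteratedDeriv (j + 1) Up) :=
      hUp.continuous_iteratedDeriv (j + 1) (by exact_mod_cast Nat.succ_le_succ hj)
    refine ((hc.const_mul βp).tendsto α |>.mono_left nhdsWithin_le_nhds).congr' ?_
    filter_upwards [Ioo_mem_nhdsGT hαb] with x hx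
    rw [(eventuallyEq_of_eqOn_Icc hep hx).iteratedDeriv_eq, coeff, if_neg hx.1.not_gt]
  rw [tendsto_nhds_unique h1 hl, tendsto_nhds_unique h2 hr]

section Rep

variable {βm βp a α b M : ℝ} {m : ℕ} {u Um Up : ℝ → ℝ}

/-- The flux `β u'`, extended continuously across the interface and to the line. -/
def fluxOf (βm βp α : ℝ) (Um Up : ℝ → ℝ) (x : ℝ) : ℝ :=
  if x ≤ α then βm * deriv Um x else βp * deriv Up x

theorem abs_deriv_sub_taylorPoly_le {U : ℝ → ℝ} (hM : 0 ≤ M)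
    (hU : ContDiff ℝ ((m + 1 : ℕ) : WithTop ℕ∞) U)
    (hLip : ∀ x y, |iteratedDeriv (m + 1) U x - iteratedDeriv (m + 1) U y| ≤ M * |x - y|)
    (x0 x : ℝ) : |deriv U x - (taylorPoly m x0 fun j => iteratedDeriv (j + 1) U x0).eval x| ≤
      M * |x - x0| ^ (m + 1) := by
  have e : ((m + 1 : ℕ) : WithTop ℕ∞) = (m : WithTop ℕ∞) + 1 := by norm_cast
  rw [e, contDiff_succ_iff_deriv] at hU
  exact abs_sub_taylorPoly_le m hM hU.2.2
    (fun x y => by simpa only [iteratedDeriv_succ'] using hLip x y)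
    (fun j _ => by rw [← iteratedDeriv_succ']) x

theorem continuous_deriv_of_contDiff_succ {U : ℝ → ℝ} {n : ℕ}
    (hU : ContDiff ℝ ((n + 1 : ℕ) : WithTop ℕ∞) U) : Continuous (deriv U) :=
  hU.continuous_deriv (by exact_mod_cast Nat.succ_le_succ n.zero_le)

theorem differentiable_of_contDiff_succ {U : ℝ → ℝ} {n : ℕ}
    (hU : ContDiff ℝ ((n + 1 : ℕ) : WithTop ℕ∞) U) : Differentiable ℝ U :=
  hU.differentiable (by exact_mod_cast n.succ_ne_zero)

theorem IsSmoothRep.isFlux (h : IsSmoothRep βm βp a α b M m u Um Up) (hm : 0 < βm) (hp : 0 < βp)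
    (haα : a < α) (hαb : α < b) :
    IsFlux (fun x => (coeff βm βp α x)⁻¹) α a b u (fluxOf βm βp α Um Up) := by
  refine ⟨?_, ?_, fun x hx hxα => ?_⟩
  · rw [← Icc_union_Icc_eq_Icc haα.le hαb.le]
    refine ContinuousOn.union_of_isClosed ?_ ?_ isClosed_Icc isClosed_Icc
    · exact h.contDiff_left.continuous.continuousOn.congr h.eqOn_left
    · exact h.contDiff_right.continuous.continuousOn.congr h.eqOn_right
  · refine Continuous.if_le ?_ ?_ continuous_id continuous_const ?_
    · exact continuous_const.mul (continuous_deriv_of_contDiff_succ h.contDiff_left)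
    · exact continuous_const.mul (continuous_deriv_of_contDiff_succ h.contDiff_right)
    · rintro x rfl
      simpa using h.jump 0 m.zero_le
  · rcases hxα.lt_or_gt with hlt | hgt
    · have e := eventuallyEq_of_eqOn_Icc h.eqOn_left ⟨hx.1, hlt⟩
      refine ((differentiable_of_contDiff_succ h.contDiff_left x).hasDerivAt.congr_of_eventuallyEq
        e).congr_deriv ?_
      rw [coeff, if_pos hlt, fluxOf, if_pos hlt.le, inv_mul_cancel_left₀ hm.ne']
    · have e := eventuallyEq_of_eqOn_Icc h.eqOn_right ⟨hgt, hx.2⟩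
      refine ((differentiable_of_contDiff_succ h.contDiff_right x).hasDerivAt.congr_of_eventuallyEq
        e).congr_deriv ?_
      rw [coeff, if_neg hgt.not_gt, fluxOf, if_neg (not_le.2 hgt), inv_mul_cancel_left₀ hp.ne']

/-- The jump conditions make the one-sided Taylor polynomials of the flux at the interface
agree, so that a single polynomial approximates the flux on both sides. -/
theorem IsSmoothRep.exists_taylor (h : IsSmoothRep βm βp a α b M m u Um Up) (hm : 0 < βm)
    (hp : 0 < βp) : ∃ T : ℝ[X], T.degree < ((m + 1 : ℕ) : WithBot ℕ) ∧
      ∀ x, |fluxOf βm βp α Um Up x - T.eval x| ≤ max βm βp * M * |x - α| ^ (m + 1) := by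
  refine ⟨C βm * taylorPoly m α fun j => iteratedDeriv (j + 1) Um α, ?_, fun x => ?_⟩
  · rw [← smul_eq_C_mul]
    exact (degree_smul_le _ _).trans_lt (degree_taylorPoly_lt _ _ _)
  have hMx : 0 ≤ M * |x - α| ^ (m + 1) := mul_nonneg h.nonneg (by positivity)
  rw [eval_mul, eval_C, fluxOf]
  split_ifs with hx
  · rw [← mul_sub, abs_mul, abs_of_pos hm, mul_assoc]
    exact mul_le_mul (le_max_left _ _)
      (abs_deriv_sub_taylorPoly_le h.nonneg h.contDiff_left h.lip_left α x) (abs_nonneg _)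
      (hm.le.trans (le_max_left _ _))
  · have e : βm * (taylorPoly m α fun j => iteratedDeriv (j + 1) Um α).eval x =
        βp * (taylorPoly m α fun j => iteratedDeriv (j + 1) Up α).eval x := by
      rw [eval_taylorPoly, eval_taylorPoly, Finset.mul_sum, Finset.mul_sum]
      refine Finset.sum_congr rfl fun j hj => ?_
      have := h.jump j (Nat.lt_succ_iff.1 (Finset.mem_range.1 hj))
      linear_combination ((x - α) ^ j / (j.factorial : ℝ)) * this
    rw [e, ← mul_sub, abs_mul, abs_of_pos hp, mul_assoc]
    exact mul_le_mul (le_max_right _ _)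
      (abs_deriv_sub_taylorPoly_le h.nonneg h.contDiff_right h.lip_right α x) (abs_nonneg _)
      (hp.le.trans (le_max_right _ _))

end Rep

/-! ### Weak form of the interface problem -/

section WeakForm

theorem integral_flux_side {U v f : ℝ → ℝ} {c d β : ℝ} (hU : ContDiff ℝ 2 U) (hcd : c ≤ d)
    (hv : PiecewiseDiff c d v)
    (hf : ∀ᵐ x, x ∈ Ioo c d → f x = -(β * deriv (deriv U) x)) :
    IntervalIntegrable (fun x => f x * v x) volume c d ∧
      ∫ x in c..d, β * deriv U x * deriv v x =
        β * (deriv U d * v d - deriv U c * v c) + ∫ x in c..d, f x * v x := by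
  have e : (2 : WithTop ℕ∞) = 1 + 1 := by norm_num
  have hU1 : ContDiff ℝ 1 (deriv U) := by
    rw [e, contDiff_succ_iff_deriv] at hU; exact hU.2.2
  have hU2 : Continuous (deriv (deriv U)) := hU1.continuous_deriv le_rfl
  have hparts := (PiecewiseDiff.of_contDiff hU1 c d).integral_parts hv hcd
  have i1 : IntervalIntegrable (fun x => deriv (deriv U) x * v x) volume c d :=
    (hU2.continuousOn.mul hv.continuousOn).intervalIntegrable_of_Icc hcd
  have i2 : IntervalIntegrable (fun x => deriv U x * deriv v x) volume c d := by
    simpa only [mul_comm] using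
      hv.intervalIntegrable_deriv_mul hcd hU1.continuous.continuousOn
  have hae : ∀ᵐ x, x ∈ uIoc c d → -β * (deriv (deriv U) x * v x) = f x * v x := by
    filter_upwards [hf, ae_notMem_of_finite (finite_singleton d) volume] with x hx hxd hxI
    rw [uIoc_of_le hcd] at hxI
    rw [hx ⟨hxI.1, hxI.2.lt_of_ne hxd⟩]
    ring
  refine ⟨(i1.const_mul (-β)).congr_ae ((ae_restrict_iff' measurableSet_uIoc).2 hae), ?_⟩
  rw [intervalIntegral.integral_add i1 i2] at hparts
  rw [← intervalIntegral.integral_congr_ae hae, intervalIntegral.integral_const_mul]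
  have : (fun x => β * deriv U x * deriv v x) = fun x => β * (deriv U x * deriv v x) := by
    ext x; ring
  rw [this, intervalIntegral.integral_const_mul]
  linear_combination β * hparts

theorem coeff_pos {βm βp α : ℝ} (hm : 0 < βm) (hp : 0 < βp) (x : ℝ) : 0 < coeff βm βp α x := by
  unfold coeff; split_ifs <;> assumption

theorem measurable_coeff (βm βp α : ℝ) : Measurable (coeff βm βp α) :=
  Measurable.ite measurableSet_Iio measurable_const measurable_const

theorem PiecewiseDiff.intervalIntegrable_coeff_mul {βm βp α c d : ℝ} {v z : ℝ → ℝ}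
    (hm : 0 < βm) (hp : 0 < βp) (hcd : c ≤ d) (hv : PiecewiseDiff c d v)
    (hz : PiecewiseDiff c d z) :
    IntervalIntegrable (fun x => coeff βm βp α x * deriv v x * deriv z x) volume c d := by
  rw [intervalIntegrable_iff_integrableOn_Ioo_of_le hcd]
  have h : Integrable (fun x => deriv v x * deriv z x) (volume.restrict (Ioo c d)) :=
    (hv.memLp_deriv 2).integrable_mul (hz.memLp_deriv 2)
  have h2 := h.bdd_mul (c := max βm βp) (measurable_coeff βm βp α).aestronglyMeasurable
    (Eventually.of_forall fun x => by
      rw [Real.norm_eq_abs, abs_of_pos (coeff_pos hm hp x)]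
      unfold coeff; split_ifs
      · exact le_max_left _ _
      · exact le_max_right _ _)
  refine h2.congr (Eventually.of_forall fun x => ?_)
  simp only [mul_assoc]

/-- The weak form `(β u', v') = (f, v)` for piecewise differentiable test functions: integrate by
parts on both sides of the interface; the boundary terms at `α` cancel. -/
theorem IsSmoothRep.weak_form {βm βp a α b M : ℝ} {m : ℕ} {u Um Up f v : ℝ → ℝ}
    (h : IsSmoothRep βm βp a α b M (m + 1) u Um Up) (hm : 0 < βm) (hp : 0 < βp) (haα : a < α)
    (hαb : α < b) (hf : IsExactSolution βm βp a α b f u) (hv : PiecewiseDiff a b v)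
    (hva : v a = 0) (hvb : v b = 0) :
    ∫ x in a..b, coeff βm βp α x * deriv u x * deriv v x = ∫ x in a..b, f x * v x := by
  have hle : (2 : WithTop ℕ∞) ≤ ((m + 1 + 1 : ℕ) : WithTop ℕ∞) := by
    exact_mod_cast (by omega : 2 ≤ m + 1 + 1)
  have hvm := hv.mono le_rfl hαb.le
  have hvp := hv.mono haα.le le_rfl
  have hderiv : ∀ {U : ℝ → ℝ} {c d x : ℝ}, EqOn u U (Icc c d) → x ∈ Ioo c d →
      deriv u x = deriv U x := fun hU hx => (eventuallyEq_of_eqOn_Icc hU hx).deriv_eq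
  have hfm : ∀ᵐ x, x ∈ Ioo a α → f x = -(βm * deriv (deriv Um) x) := by
    filter_upwards [hf.eqn] with x hx hxI
    rw [← hx (Or.inl hxI)]
    have e : (fun y => coeff βm βp α y * deriv u y) =ᶠ[𝓝 x] fun y => βm * deriv Um y := by
      filter_upwards [Ioo_mem_nhds hxI.1 hxI.2] with y hy
      rw [hderiv h.eqOn_left hy, coeff, if_pos hy.2]
    rw [e.deriv_eq, deriv_const_mul_field]
  have hfp : ∀ᵐ x, x ∈ Ioo α b → f x = -(βp * deriv (deriv Up) x) := by
    filter_upwards [hf.eqn] with x hx hxI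
    rw [← hx (Or.inr hxI)]
    have e : (fun y => coeff βm βp α y * deriv u y) =ᶠ[𝓝 x] fun y => βp * deriv Up y := by
      filter_upwards [Ioo_mem_nhds hxI.1 hxI.2] with y hy
      rw [hderiv h.eqOn_right hy, coeff, if_neg hy.1.not_gt]
    rw [e.deriv_eq, deriv_const_mul_field]
  obtain ⟨i1, e1⟩ := integral_flux_side (h.contDiff_left.of_le hle) haα.le hvm hfm
  obtain ⟨i2, e2⟩ := integral_flux_side (h.contDiff_right.of_le hle) hαb.le hvp hfp
  have hu : PiecewiseDiff a b u :=
    (h.isFlux hm hp haα hαb).piecewiseDiff (isWeight_coeff_inv hm hp α)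
  have c1 : ∫ x in a..α, coeff βm βp α x * deriv u x * deriv v x =
      ∫ x in a..α, βm * deriv Um x * deriv v x :=
    integral_congr_off_singleton (s := α) haα.le fun x hx _ => by
      rw [hderiv h.eqOn_left hx, coeff, if_pos hx.2]
  have c2 : ∫ x in α..b, coeff βm βp α x * deriv u x * deriv v x =
      ∫ x in α..b, βp * deriv Up x * deriv v x :=
    integral_congr_off_singleton (s := α) hαb.le fun x hx _ => by
      rw [hderiv h.eqOn_right hx, coeff, if_neg hx.1.not_gt]
  have hj := h.jump 0 (Nat.zero_le _)
  simp only [zero_add, iteratedDeriv_one] at hj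
  rw [← intervalIntegral.integral_add_adjacent_intervals i1 i2,
    ← intervalIntegral.integral_add_adjacent_intervals
      ((hu.mono le_rfl hαb.le).intervalIntegrable_coeff_mul hm hp haα.le hvm)
      ((hu.mono haα.le le_rfl).intervalIntegrable_coeff_mul hm hp hαb.le hvp), c1, c2, e1, e2,
    hva, hvb]
  linear_combination v α * hj

/-- Definiteness of the energy form. -/
theorem PiecewiseDiff.eq_zero_of_energy {βm βp α a b : ℝ} {v : ℝ → ℝ} (hm : 0 < βm) (hp : 0 < βp)
    (hab : a ≤ b) (hv : PiecewiseDiff a b v) (hva : v a = 0)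
    (h : ∫ x in a..b, coeff βm βp α x * deriv v x * deriv v x = 0) : ∀ x ∈ Icc a b, v x = 0 := by
  intro x hx
  have hnn : ∀ x, 0 ≤ coeff βm βp α x * deriv v x * deriv v x := fun x => by
    rw [mul_assoc]; exact mul_nonneg (coeff_pos hm hp x).le (mul_self_nonneg _)
  rw [intervalIntegral.integral_eq_zero_iff_of_le_of_nonneg_ae hab (Eventually.of_forall hnn)
    (hv.intervalIntegrable_coeff_mul hm hp hab hv)] at h
  have h0 : ∀ᵐ t, t ∈ Ioc a b → deriv v t = 0 := by
    rw [← ae_restrict_iff' measurableSet_Ioc]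
    filter_upwards [h] with t ht
    simp only [Pi.zero_apply, mul_eq_zero, (coeff_pos hm hp t).ne', false_or, or_self] at ht
    exact ht
  have h1 := (hv.mono le_rfl hx.2).integral_deriv hx.1
  rw [hva, sub_zero] at h1
  rw [← h1]
  refine intervalIntegral.integral_zero_ae ?_
  filter_upwards [h0] with t ht htI
  rw [uIoc_of_le hx.1] at htI
  exact ht ⟨htI.1, htI.2.trans hx.2⟩

end WeakForm

/-! ### Meshes and gluing -/

namespace Mesh

variable {a b : ℝ} {N : ℕ} (T : Mesh a b N)

theorem lft_lt_rgt (i : Fin N) : T.lft i < T.rgt i := T.strictMono Fin.castSucc_lt_succ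

theorem node_mem (j : Fin (N + 1)) : T.node j ∈ Icc a b :=
  ⟨T.node_zero.symm.le.trans (T.strictMono.monotone (Fin.zero_le _)),
    (T.strictMono.monotone (Fin.le_last _)).trans T.node_last.le⟩

theorem le_lft (i : Fin N) : a ≤ T.lft i := (T.node_mem _).1

theorem rgt_le (i : Fin N) : T.rgt i ≤ b := (T.node_mem _).2

theorem rgt_le_lft {i j : Fin N} (h : i < j) : T.rgt i ≤ T.lft j :=
  T.strictMono.monotone (Fin.succ_le_castSucc_iff.2 h)

theorem length_le_size (i : Fin N) : T.rgt i - T.lft i ≤ T.size :=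
  le_ciSup (f := fun i => T.rgt i - T.lft i) (Set.finite_range _).bddAbove i

theorem lft_zero (h : 0 < N) : T.lft ⟨0, h⟩ = a := T.node_zero

theorem exists_mem_Icc (hN : 0 < N) {x : ℝ} (hx : x ∈ Icc a b) :
    ∃ i, x ∈ Icc (T.lft i) (T.rgt i) := by
  have key : ∀ j : Fin (N + 1), x ≤ T.node j → ∃ i, x ∈ Icc (T.lft i) (T.rgt i) := by
    intro j
    induction j using Fin.induction with
    | zero =>
      intro h
      rw [T.node_zero] at h
      refine ⟨⟨0, hN⟩, ?_, ?_⟩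
      · rw [T.lft_zero hN]; exact hx.1
      · exact h.trans ((T.lft_zero hN).symm.le.trans (T.lft_lt_rgt _).le)
    | succ i ih =>
      intro h
      rcases le_total x (T.node i.castSucc) with h' | h'
      · exact ih h'
      · exact ⟨i, h', h⟩
  exact key (Fin.last N) (by rw [T.node_last]; exact hx.2)

theorem integral_eq_zero {F : ℝ → ℝ} (hF : IntervalIntegrable F volume a b)
    (h : ∀ i, ∫ x in T.lft i..T.rgt i, F x = 0) : ∫ x in a..b, F x = 0 := by
  have hnode : ∀ j, T.node j ∈ uIcc a b := fun j => Icc_subset_uIcc (T.node_mem j)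
  have key : ∀ j : Fin (N + 1), ∫ x in a..T.node j, F x = 0 := by
    intro j
    induction j using Fin.induction with
    | zero => rw [T.node_zero, intervalIntegral.integral_same]
    | succ i ih =>
      rw [← intervalIntegral.integral_add_adjacent_intervals (b := T.node i.castSucc), ih, zero_add]
      · exact h i
      · exact hF.mono_set (uIcc_subset_uIcc left_mem_uIcc (hnode _))
      · exact hF.mono_set (uIcc_subset_uIcc (hnode _) (hnode _))
  rw [← key (Fin.last N), T.node_last]

theorem continuousOn_of_elements (hN : 0 < N) {v : ℝ → ℝ}
    (h : ∀ i, ContinuousOn v (Icc (T.lft i) (T.rgt i))) : ContinuousOn v (Icc a b) :=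
  ((locallyFinite_of_finite _).continuousOn_iUnion (fun _ => isClosed_Icc) h).mono
    fun _ hx => mem_iUnion.2 (T.exists_mem_Icc hN hx)

theorem piecewiseDiff_of_elements (hN : 0 < N) {v : ℝ → ℝ}
    (h : ∀ i, PiecewiseDiff (T.lft i) (T.rgt i) v) : PiecewiseDiff a b v := by
  refine ⟨T.continuousOn_of_elements hN fun i => (h i).continuousOn, ?_⟩
  choose s B hs hB using fun i => (h i).deriv_bdd
  refine ⟨(⋃ i, s i) ∪ range T.node, ∑ i, |B i|, (finite_iUnion hs).union (finite_range _),
    fun x hx hxs => ?_⟩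
  obtain ⟨i, hi⟩ := T.exists_mem_Icc hN (Ioo_subset_Icc_self hx)
  have hn : ∀ j, T.node j ≠ x := fun j hj => hxs (Or.inr ⟨j, hj⟩)
  obtain ⟨h1, h2⟩ := hB i x ⟨hi.1.lt_of_ne (hn _), hi.2.lt_of_ne (hn _).symm⟩
    fun hxi => hxs (Or.inl (mem_iUnion.2 ⟨i, hxi⟩))
  exact ⟨h1, h2.trans ((le_abs_self _).trans
    (Finset.single_le_sum (fun i _ => abs_nonneg (B i)) (Finset.mem_univ i)))⟩

/-- Functions on the elements that take the values of `u` at the nodes are the restrictions of one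
function. -/
theorem exists_glue {u : ℝ → ℝ} {I : Fin N → ℝ → ℝ} (hl : ∀ i, I i (T.lft i) = u (T.lft i))
    (hr : ∀ i, I i (T.rgt i) = u (T.rgt i)) :
    ∃ W : ℝ → ℝ, ∀ i, EqOn W (I i) (Icc (T.lft i) (T.rgt i)) := by
  classical
  refine ⟨fun x => if h : ∃ i, x ∈ Icc (T.lft i) (T.rgt i) then I h.choose x else 0,
    fun i x hx => ?_⟩
  have hex : ∃ i, x ∈ Icc (T.lft i) (T.rgt i) := ⟨i, hx⟩
  simp only [dif_pos hex]
  have hj := hex.choose_spec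
  generalize hex.choose = j at hj
  have key : ∀ i j : Fin N, i < j → x ∈ Icc (T.lft i) (T.rgt i) → x ∈ Icc (T.lft j) (T.rgt j) →
      I i x = u x ∧ I j x = u x := by
    intro i j hij hi hj
    have h1 := T.rgt_le_lft hij
    have e1 : x = T.rgt i := le_antisymm hi.2 (h1.trans hj.1)
    have e2 : x = T.lft j := le_antisymm (hi.2.trans h1) hj.1
    exact ⟨by rw [e1, hr], by rw [e2, hl]⟩
  rcases lt_trichotomy i j with h | rfl | h
  · obtain ⟨h1, h2⟩ := key i j h hx hj
    rw [h1, h2]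
  · rfl
  · obtain ⟨h1, h2⟩ := key j i h hj hx
    rw [h1, h2]

end Mesh

/-! ### The discrete solution is the interpolant -/

section

variable {w : ℝ → ℝ} {lo hi s x0 x1 : ℝ} {u v G H : ℝ → ℝ}

theorem IsFlux.congr (h : IsFlux w s x0 x1 u G) (hv : EqOn v u (Icc x0 x1)) :
    IsFlux w s x0 x1 v G :=
  ⟨h.continuousOn.congr hv, h.continuous, fun x hx hxs =>
    (h.hasDerivAt x hx hxs).congr_of_eventuallyEq (eventuallyEq_of_eqOn_Icc hv hx)⟩

/-- Functions in the span of a Lobatto family of order `p` have polynomial flux of degree less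
than `p`. -/
theorem IsLobattoFamily.exists_isFlux_of_mem_span {φ : ℕ → ℝ → ℝ} {Q : ℕ → ℝ[X]}
    (hφ : IsLobattoFamily w s x0 x1 φ Q) {p : ℕ} (hp : 1 ≤ p) {g : ℝ → ℝ}
    (hg : g ∈ Submodule.span ℝ {g : ℝ → ℝ | ∃ n ≤ p, g = φ n}) :
    Continuous g ∧ ∃ r : ℝ[X], r.degree < p ∧ IsFlux w s x0 x1 g (fun x => r.eval x) := by
  induction hg using Submodule.span_induction with
  | mem g hg =>
    obtain ⟨n, hn, rfl⟩ := hg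
    obtain ⟨c, -, hc⟩ := hφ.hasDerivAt n
    refine ⟨hφ.continuous n, C c * Q (n - 1), ?_, (hφ.continuous n).continuousOn, by fun_prop,
      fun x _ hxs => ?_⟩
    · rw [← smul_eq_C_mul]
      refine (degree_smul_le _ _).trans_lt ?_
      rw [(hφ.ortho _).degree_eq]
      norm_cast; omega
    · rw [eval_mul, eval_C]; exact hc x hxs
  | zero =>
    refine ⟨continuous_const, 0, by simp, continuousOn_const, by fun_prop, fun x _ _ => ?_⟩
    simp only [eval_zero, mul_zero]
    exact hasDerivAt_const x (0 : ℝ)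
  | add g g' _ _ h h' =>
    obtain ⟨hc, r, hr, hf⟩ := h
    obtain ⟨hc', r', hr', hf'⟩ := h'
    refine ⟨hc.add hc', r + r', (degree_add_le _ _).trans_lt (max_lt hr hr'),
      (hc.add hc').continuousOn, by fun_prop, fun x hx hxs => ?_⟩
    rw [eval_add, mul_add]
    exact (hf.hasDerivAt x hx hxs).add (hf'.hasDerivAt x hx hxs)
  | smul c g _ h =>
    obtain ⟨hc, r, hr, hf⟩ := h
    refine ⟨hc.const_smul c, c • r, (degree_smul_le _ _).trans_lt hr,
      (hc.const_smul c).continuousOn, by fun_prop, fun x hx hxs => ?_⟩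
    rw [eval_smul, smul_eq_mul]
    exact ((hf.hasDerivAt x hx hxs).const_mul c).congr_deriv (by ring)

theorem eqOn_Icc_of_eqOn_Ioo (h01 : x0 < x1) (hu : ContinuousOn u (Icc x0 x1)) (hv : Continuous v)
    (h : EqOn u v (Ioo x0 x1)) : EqOn u v (Icc x0 x1) := by
  rw [← closure_Ioo h01.ne] at hu ⊢
  exact h.of_subset_closure hu hv.continuousOn subset_closure subset_rfl

theorem IsLobattoFamily.exists_isFlux_of_eqOn {φ : ℕ → ℝ → ℝ} {Q : ℕ → ℝ[X]}
    (hφ : IsLobattoFamily w s x0 x1 φ Q) (h01 : x0 < x1) {p : ℕ} (hp : 1 ≤ p)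
    (hu : ContinuousOn u (Icc x0 x1))
    (h : ∃ g ∈ Submodule.span ℝ {g : ℝ → ℝ | ∃ n ≤ p, g = φ n}, EqOn u g (Ioo x0 x1)) :
    ∃ r : ℝ[X], r.degree < p ∧ IsFlux w s x0 x1 u (fun x => r.eval x) := by
  obtain ⟨g, hg, hug⟩ := h
  obtain ⟨hc, r, hr, hf⟩ := hφ.exists_isFlux_of_mem_span hp hg
  exact ⟨r, hr, hf.congr (eqOn_Icc_of_eqOn_Ioo h01 hu hc hug)⟩

/-- Galerkin orthogonality of the interpolation error on one element, where the coefficient is a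
multiple of `1 / w`. -/
theorem IsLobattoApprox.integral_eq_zero (h01 : x0 < x1) {p : ℕ} {ε ε' : ℝ}
    {φ I β : ℝ → ℝ} {P q r : ℝ[X]} (h : IsLobattoApprox w s x0 x1 p ε ε' u G φ P I q)
    (hu : IsFlux w s x0 x1 u G) (hv : IsFlux w s x0 x1 v (fun x => r.eval x)) (hr : r.degree < p)
    {κ : ℝ} (hκ : ∀ x ∈ Ioo x0 x1, x ≠ s → β x * w x = κ) :
    ∫ x in x0..x1, β x * (deriv u x - deriv I x) * (deriv I x - deriv v x) = 0 := by
  have ho := h.ortho (q - r) ((degree_sub_le _ _).trans_lt (max_lt h.degree_lt hr))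
  have e : ∫ x in x0..x1, β x * (deriv u x - deriv I x) * (deriv I x - deriv v x) =
      ∫ x in x0..x1, κ * (w x * ((G x - q.eval x) * (q - r).eval x)) :=
    integral_congr_off_singleton (s := s) h01.le fun x hx hxs => by
      rw [(hu.hasDerivAt x hx hxs).deriv, (h.isFlux.hasDerivAt x hx hxs).deriv,
        (hv.hasDerivAt x hx hxs).deriv, ← hκ x hx hxs, eval_sub]
      ring
  rw [e, intervalIntegral.integral_const_mul]
  rw [ip] at ho
  rw [ho, mul_zero]

end

namespace Mesh

variable {a b : ℝ} {N : ℕ} (T : Mesh a b N)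

/-- Functions `I i` on the elements that interpolate `u` at the nodes, lie in the local spaces, and
satisfy Galerkin orthogonality element by element make up the discrete solution: their difference
to the discrete solution is an admissible test function of zero energy. -/
theorem IsIFESolution.eqOn {βm βp α : ℝ} (hm : 0 < βm) (hp : 0 < βp) {k : Fin N} {p : ℕ}
    {f u uh : ℝ → ℝ} (huh : T.IsIFESolution βm βp α k p f uh)
    (hu : PiecewiseDiff a b u) (hua : u a = 0) (hub : u b = 0)
    (hweak : ∀ v, PiecewiseDiff a b v → v a = 0 → v b = 0 →
      ∫ x in a..b, coeff βm βp α x * deriv u x * deriv v x = ∫ x in a..b, f x * v x)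
    {I : Fin N → ℝ → ℝ} (hIl : ∀ i, I i (T.lft i) = u (T.lft i))
    (hIr : ∀ i, I i (T.rgt i) = u (T.rgt i))
    (hIn : ∀ i, i ≠ k → I i ∈ Submodule.span ℝ {g : ℝ → ℝ | ∃ n ≤ p, g = T.lobatto i n})
    (hIk : I k ∈ Submodule.span ℝ {g : ℝ → ℝ | ∃ n ≤ p, g = T.genLobatto βm βp α k n})
    (hId : ∀ i, PiecewiseDiff (T.lft i) (T.rgt i) (I i))
    (huhd : ∀ i, PiecewiseDiff (T.lft i) (T.rgt i) uh)
    (horth : ∀ i, ∫ x in T.lft i..T.rgt i, coeff βm βp α x * (deriv u x - deriv (I i) x) *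
      (deriv (I i) x - deriv uh x) = 0) (i : Fin N) :
    EqOn uh (I i) (Icc (T.lft i) (T.rgt i)) := by
  have hN : 0 < N := k.pos
  have hab : a ≤ b := (T.le_lft k).trans ((T.lft_lt_rgt k).le.trans (T.rgt_le k))
  obtain ⟨W, hW⟩ := T.exists_glue hIl hIr
  have hdW : ∀ i, ∀ x ∈ Ioo (T.lft i) (T.rgt i), W =ᶠ[𝓝 x] I i := fun i x hx =>
    eventuallyEq_of_eqOn_Icc (hW i) hx
  have hWd : PiecewiseDiff a b W := T.piecewiseDiff_of_elements hN fun i => by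
    obtain ⟨s, B, hs, h⟩ := (hId i).deriv_bdd
    refine ⟨(hId i).continuousOn.congr (hW i), s, B, hs, fun x hx hxs => ?_⟩
    rw [(hdW i x hx).deriv_eq]
    exact ⟨(h x hx hxs).1.congr_of_eventuallyEq (hdW i x hx), (h x hx hxs).2⟩
  have hWa : W a = 0 := by
    obtain ⟨i, hi⟩ := T.exists_mem_Icc hN (left_mem_Icc.2 hab)
    have e : a = T.lft i := le_antisymm (T.le_lft i) hi.1
    rw [hW i hi, ← hua]
    exact (congrArg (I i) e).trans ((hIl i).trans (congrArg u e.symm))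
  have hWb : W b = 0 := by
    obtain ⟨i, hi⟩ := T.exists_mem_Icc hN (right_mem_Icc.2 hab)
    have e : b = T.rgt i := le_antisymm hi.2 (T.rgt_le i)
    rw [hW i hi, ← hub]
    exact (congrArg (I i) e).trans ((hIr i).trans (congrArg u e.symm))
  have huhD : PiecewiseDiff a b uh := T.piecewiseDiff_of_elements hN huhd
  obtain ⟨hmem, hgal⟩ := huh
  have hvD := hWd.sub huhD
  have hva : W a - uh a = 0 := by rw [hWa, hmem.memH10.2.2.1, sub_self]
  have hvb : W b - uh b = 0 := by rw [hWb, hmem.memH10.2.2.2, sub_self]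
  have hvS : T.MemSpace βm βp α k p (fun x => W x - uh x) := by
    refine ⟨hvD.memH10 hab hva hvb, fun i hik => ?_, ?_⟩
    · obtain ⟨g, hg, hug⟩ := hmem.nonInterface i hik
      refine ⟨I i - g, Submodule.sub_mem _ (hIn i hik) hg, fun x hx => ?_⟩
      change W x - uh x = I i x - g x
      rw [hW i (Ioo_subset_Icc_self hx), hug hx]
    · obtain ⟨g, hg, hug⟩ := hmem.interface
      refine ⟨I k - g, Submodule.sub_mem _ hIk hg, fun x hx => ?_⟩
      change W x - uh x = I k x - g x
      rw [hW k (Ioo_subset_Icc_self hx), hug hx]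
  set v : ℝ → ℝ := fun x => W x - uh x with hv
  have e1 := hgal v hvS
  rw [← hweak v hvD hva hvb] at e1
  have iu := hu.intervalIntegrable_coeff_mul (α := α) hm hp hab hvD
  have iuh := huhD.intervalIntegrable_coeff_mul (α := α) hm hp hab hvD
  have iv := hvD.intervalIntegrable_coeff_mul (α := α) hm hp hab hvD
  have hzero := T.integral_eq_zero ((iu.sub iuh).sub iv) fun i => by
    rw [← horth i]
    refine intervalIntegral.integral_congr_ae ?_
    filter_upwards [hWd.ae_deriv_sub huhD,
      ae_notMem_of_finite (finite_singleton (T.rgt i)) volume] with x hx hxr hxI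
    rw [uIoc_of_le (T.lft_lt_rgt i).le] at hxI
    have hxi : x ∈ Ioo (T.lft i) (T.rgt i) := ⟨hxI.1, hxI.2.lt_of_ne hxr⟩
    have h1 := hx ⟨(T.le_lft i).trans_lt hxi.1, hxi.2.trans_le (T.rgt_le i)⟩
    rw [hv, h1, (hdW i x hxi).deriv_eq]
    ring
  have henergy : ∫ x in a..b, coeff βm βp α x * deriv v x * deriv v x = 0 := by
    have h1 := intervalIntegral.integral_sub (iu.sub iuh) iv
    have h2 := intervalIntegral.integral_sub iu iuh
    rw [hzero, h2, e1, sub_self, zero_sub] at h1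
    linarith
  intro x hx
  have h0 := hvD.eq_zero_of_energy hm hp hab hva henergy x
    ⟨(T.le_lft i).trans hx.1, hx.2.trans (T.rgt_le i)⟩
  rw [← hW i hx]
  exact (sub_eq_zero.1 h0).symm

end Mesh

/-! ### Superconvergence -/

theorem IsFlux.isFluxValue {βm βp α x0 x1 x : ℝ} {v G : ℝ → ℝ} (hm : 0 < βm) (hp : 0 < βp)
    (h : IsFlux (fun x => (coeff βm βp α x)⁻¹) α x0 x1 v G) (hx : x ∈ Ioo x0 x1) :
    IsFluxValue βm βp α v x (G x) := by
  have key : ∀ y ∈ Ioo x0 x1, y ≠ α → coeff βm βp α y * deriv v y = G y := fun y hy hyα => by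
    rw [(h.hasDerivAt y hy hyα).deriv, mul_inv_cancel_left₀ (coeff_pos hm hp y).ne']
  have hne : ∀ᶠ y in 𝓝[≠] x, y ∈ Ioo x0 x1 ∧ y ≠ α := by
    refine (eventually_nhdsWithin_of_eventually_nhds (Ioo_mem_nhds hx.1 hx.2)).and ?_
    rcases eq_or_ne x α with rfl | hxα
    · exact eventually_mem_nhdsWithin
    · exact eventually_nhdsWithin_of_eventually_nhds (isOpen_ne.mem_nhds hxα)
  refine ⟨hne.mono fun y hy => (h.hasDerivAt y hy.1 hy.2).differentiableAt, ?_,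
    fun hxα => ⟨(h.hasDerivAt x hx hxα).differentiableAt, key x hx hxα⟩⟩
  exact (h.continuous.continuousAt.tendsto.mono_left nhdsWithin_le_nhds).congr'
    (hne.mono fun y hy => (key y hy.1 hy.2).symm)

theorem eval_comp_affine (P : ℝ[X]) {x0 x1 : ℝ} (x : ℝ) :
    (P.comp (C (2 / (x1 - x0)) * X + C (-(x0 + x1) / (x1 - x0)))).eval x =
      P.eval ((2 * x - x0 - x1) / (x1 - x0)) := by
  simp only [eval_comp, eval_add, eval_mul, eval_C, eval_X]
  congr 1; ring

theorem Mesh.isLobattoFamily_lobatto {a b : ℝ} {N : ℕ} (T : Mesh a b N) (i : Fin N) :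
    IsLobattoFamily (fun _ => 1) (T.lft i) (T.lft i) (T.rgt i) (T.lobatto i)
      (fun n => (IFE.legendre n).comp
        (C (2 / (T.rgt i - T.lft i)) * X + C (-(T.lft i + T.rgt i) / (T.rgt i - T.lft i)))) :=
  (lobatto_isLobattoFamily (-1)).comp_affine (T.lft_lt_rgt i) (fun _ => rfl) fun x hx hx1 => hx (by
    rw [div_eq_iff (sub_pos.2 (T.lft_lt_rgt i)).ne'] at hx1
    linarith)

/-- Interpolation on an element away from the interface, where the solution is smooth and the
weight may be taken to be `1`. The exceptional point of the flux is put at an end point, so that it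
excludes nothing. -/
theorem Mesh.exists_isLobattoApprox_of_ne {a b βm βp α M : ℝ} {N : ℕ} (T : Mesh a b N) {k i : Fin N}
    (hki : i ≠ k) (hk0 : T.lft k ≤ α) (hk1 : α ≤ T.rgt k) {p : ℕ} (hp : 1 ≤ p)
    {u Um Up : ℝ → ℝ} (h : IsSmoothRep βm βp a α b M p u Um Up) :
    ∃ (G : ℝ → ℝ) (κ : ℝ) (q : ℝ[X]), IsFlux (fun _ => 1) (T.lft i) (T.lft i) (T.rgt i) u G ∧
      (∀ x ∈ Ioo (T.lft i) (T.rgt i), coeff βm βp α x = κ) ∧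
      IsLobattoApprox (fun _ => 1) (T.lft i) (T.lft i) (T.rgt i) p
        (stab p 1 * (M * (T.rgt i - T.lft i) ^ (p + 1)))
        ((T.rgt i - T.lft i) * (stab p 1 * (M * (T.rgt i - T.lft i) ^ (p + 1)))) u G
        (T.lobatto i (p + 1)) ((IFE.legendre p).comp
          (C (2 / (T.rgt i - T.lft i)) * X + C (-(T.lft i + T.rgt i) / (T.rgt i - T.lft i))))
        (T.interp βm βp α k p u i) q := by
  have h01 := T.lft_lt_rgt i
  -- the one-sided representative that agrees with `u` on the element
  obtain ⟨U, κ, hU, hLip, heq, hκ⟩ : ∃ (U : ℝ → ℝ) (κ : ℝ),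
      ContDiff ℝ ((p + 1 : ℕ) : WithTop ℕ∞) U ∧
      (∀ x y, |iteratedDeriv (p + 1) U x - iteratedDeriv (p + 1) U y| ≤ M * |x - y|) ∧
      EqOn u U (Icc (T.lft i) (T.rgt i)) ∧
      ∀ x ∈ Ioo (T.lft i) (T.rgt i), coeff βm βp α x = κ := by
    rcases hki.lt_or_gt with hlt | hgt
    · have h1 := (T.rgt_le_lft hlt).trans hk0
      exact ⟨Um, βm, h.contDiff_left, h.lip_left,
        h.eqOn_left.mono (Icc_subset_Icc (T.le_lft i) h1),
        fun x hx => if_pos (hx.2.trans_le h1)⟩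
    · have h1 := hk1.trans (T.rgt_le_lft hgt)
      exact ⟨Up, βp, h.contDiff_right, h.lip_right,
        h.eqOn_right.mono (Icc_subset_Icc h1 (T.rgt_le i)),
        fun x hx => if_neg (not_lt.2 (h1.trans hx.1.le))⟩
  have hflux : IsFlux (fun _ => 1) (T.lft i) (T.lft i) (T.rgt i) u (deriv U) :=
    IsFlux.congr ⟨hU.continuous.continuousOn, continuous_deriv_of_contDiff_succ hU, fun x _ _ => by
      rw [one_mul]; exact (differentiable_of_contDiff_succ hU x).hasDerivAt⟩ heq
  obtain ⟨q, hq⟩ := (T.isLobattoFamily_lobatto i).exists_isLobattoApprox isWeight_one h01 hflux hp (γ := T.lobattoCoeff i u)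
    rfl rfl (fun n => by simp only [inv_one, one_mul]; rfl)
    (degree_taylorPoly_lt p (T.lft i) fun j => iteratedDeriv (j + 1) U (T.lft i))
    (δ := M * (T.rgt i - T.lft i) ^ (p + 1))
    (fun x hx => (abs_deriv_sub_taylorPoly_le h.nonneg hU hLip _ x).trans (by
      refine mul_le_mul_of_nonneg_left (pow_le_pow_left₀ (abs_nonneg _) ?_ _) h.nonneg
      rw [abs_of_nonneg (sub_nonneg.2 hx.1)]
      linarith [hx.2]))
    (I := T.interp βm βp α k p u i) (fun x => by rw [Mesh.interp, if_neg hki])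
  rw [div_one, one_mul] at hq
  exact ⟨deriv U, κ, q, hflux, hκ, hq⟩

/-- Interpolation on the interface element. -/
theorem Mesh.exists_isLobattoApprox_interface {a b βm βp α M : ℝ} {N : ℕ} (T : Mesh a b N)
    {k : Fin N} (hm : 0 < βm) (hp : 0 < βp) (haα : a < α) (hαb : α < b)
    (hk0 : T.lft k ≤ α) (hk1 : α ≤ T.rgt k) {p : ℕ} (hp1 : 1 ≤ p)
    {u Um Up : ℝ → ℝ} (h : IsSmoothRep βm βp a α b M p u Um Up) :
    IsLobattoFamily (fun x => (coeff βm βp α x)⁻¹) α (T.lft k) (T.rgt k)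
      (T.genLobatto βm βp α k) (fun n => (IFE.genLegendre βm βp (T.toRef k α) n).comp
          (C (2 / (T.rgt k - T.lft k)) * X + C (-(T.lft k + T.rgt k) / (T.rgt k - T.lft k)))) ∧
    ∃ q : ℝ[X], IsLobattoApprox (fun x => (coeff βm βp α x)⁻¹) α (T.lft k) (T.rgt k) p
        (stab p (max βm βp / min βm βp) * (max βm βp * M * (T.rgt k - T.lft k) ^ (p + 1)))
        ((min βm βp)⁻¹ * (T.rgt k - T.lft k) * (stab p (max βm βp / min βm βp) *
          (max βm βp * M * (T.rgt k - T.lft k) ^ (p + 1)))) u (fluxOf βm βp α Um Up)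
        (T.genLobatto βm βp α k (p + 1)) ((IFE.genLegendre βm βp (T.toRef k α) p).comp
          (C (2 / (T.rgt k - T.lft k)) * X + C (-(T.lft k + T.rgt k) / (T.rgt k - T.lft k))))
        (T.interp βm βp α k p u k) q := by
  have h01 := T.lft_lt_rgt k
  have hh : 0 < T.rgt k - T.lft k := sub_pos.2 h01
  have hflux := (h.isFlux hm hp haα hαb).mono (T.le_lft k) (T.rgt_le k)
  have hs : T.toRef k α ∈ Icc (-1 : ℝ) 1 := by
    rw [Mesh.toRef]
    constructor
    · rw [le_div_iff₀ hh]; linarith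
    · rw [div_le_iff₀ hh]; linarith
  have hfam := (genLobatto_isLobattoFamily hm hp hs).comp_affine (s := α) h01
    (v := fun x => (coeff βm βp α x)⁻¹) (fun x => by
      have : (2 * x - T.lft k - T.rgt k) / (T.rgt k - T.lft k) < T.toRef k α ↔ x < α := by
        rw [Mesh.toRef, div_lt_div_iff_of_pos_right hh]
        constructor <;> intro h <;> linarith
      simp only [coeff, this]) (fun x hx hx1 => hx (by
      rw [Mesh.toRef, div_left_inj' hh.ne'] at hx1
      linarith))
  refine ⟨hfam, ?_⟩
  obtain ⟨S, hS, hGS⟩ := h.exists_taylor hm hp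
  have hres := hfam.exists_isLobattoApprox (isWeight_coeff_inv hm hp α) h01 hflux hp1
    (γ := T.genLobattoCoeff βm βp α k u) rfl rfl
    (fun n => by simp only [inv_inv]; rfl) hS
    (δ := max βm βp * M * (T.rgt k - T.lft k) ^ (p + 1))
    (fun x hx => (hGS x).trans (by
      refine mul_le_mul_of_nonneg_left (pow_le_pow_left₀ (abs_nonneg _) ?_ _)
        (mul_nonneg (hm.le.trans (le_max_left _ _)) h.nonneg)
      rw [abs_le]
      constructor <;> linarith [hx.1, hx.2]))
    (I := T.interp βm βp α k p u k) (fun x => by rw [Mesh.interp, if_pos rfl]; rfl)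
  rwa [inv_div_inv] at hres

end IFE

end

theorem theorem4p1 (p : ℕ) (hp : 2 ≤ p) :
    ∃ (C : ℝ) (K : ℝ → ℝ),
      ∀ (a α b βm βp : ℝ), a < α → α < b → 0 < βm → 0 < βp →
      ∀ (N : ℕ) (T : IFE.Mesh a b N) (k : Fin N), T.lft k ≤ α → α ≤ T.rgt k →
      ∀ (f u uh : ℝ → ℝ),
        IFE.MemWTilde (p + 2) ∞ βm βp a α b u →
        IFE.IsExactSolution βm βp a α b f u →
        T.IsIFESolution βm βp α k p f uh →
        -- the discrete solution is the interpolant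
        (∀ i, EqOn uh (T.interp βm βp α k p u i) (Icc (T.lft i) (T.rgt i))) ∧
        -- exactness at the mesh points
        (∀ i, u (T.node i) - uh (T.node i) = 0) ∧
        -- noninterface elements
        (∀ i, i ≠ k →
          (∀ x ∈ Icc (T.lft i) (T.rgt i), T.lobatto i (p + 1) x = 0 →
            |u x - uh x| ≤ C * T.size ^ (p + 2) * IFE.brokenSeminormInf (p + 2) a α b u) ∧
          (∀ x ∈ Icc (T.lft i) (T.rgt i), T.legendre i p x = 0 →
            DifferentiableAt ℝ u x ∧ DifferentiableAt ℝ uh x ∧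
            |deriv u x - deriv uh x| ≤
              C * T.size ^ (p + 1) * IFE.brokenSeminormInf (p + 2) a α b u)) ∧
        -- the interface element
        (∀ x ∈ Icc (T.lft k) (T.rgt k), T.genLobatto βm βp α k (p + 1) x = 0 →
          |u x - uh x| ≤ K (max βm βp / min βm βp) * T.size ^ (p + 2) *
            IFE.brokenSeminormInf (p + 2) a α b u) ∧
        (∀ x ∈ Icc (T.lft k) (T.rgt k), T.genLegendre βm βp α k p x = 0 →
          ∃ F Fh : ℝ, IFE.IsFluxValue βm βp α u x F ∧ IFE.IsFluxValue βm βp α uh x Fh ∧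
            |F - Fh| ≤ K (max βm βp / min βm βp) * max βm βp * T.size ^ (p + 1) *
              IFE.brokenSeminormInf (p + 2) a α b u) := by
  refine ⟨IFE.stab p 1, fun ρ => (1 + ρ) * IFE.stab p ρ, ?_⟩
  intro a α b βm βp haα hαb hm hβp N T k hk0 hk1 f u uh hu hf huh
  have hp1 : 1 ≤ p := by omega
  obtain ⟨Um, Up, hrep⟩ := hu.exists_isSmoothRep haα hαb
  set M := IFE.brokenSeminormInf (p + 2) a α b u
  have hM0 : 0 ≤ M := hrep.nonneg
  have hwk := IFE.isWeight_coeff_inv hm hβp α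
  have hGu := hrep.isFlux hm hβp haα hαb
  obtain ⟨hfk, qk, hqk⟩ := T.exists_isLobattoApprox_interface hm hβp haα hαb hk0 hk1 hp1 hrep
  have hGk := hGu.mono (T.le_lft k) (T.rgt_le k)
  have hfn := T.isLobattoFamily_lobatto
  have hcont : ∀ i, ContinuousOn uh (Icc (T.lft i) (T.rgt i)) := fun i =>
    huh.1.memH10.2.1.mono (Icc_subset_Icc (T.le_lft i) (T.rgt_le i))
  obtain ⟨rk, hrk, hfluxk⟩ := hfk.exists_isFlux_of_eqOn (T.lft_lt_rgt k) hp1 (hcont k)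
    huh.1.interface
  have hleft : ∀ i, T.interp βm βp α k p u i (T.lft i) = u (T.lft i) := fun i => by
    rcases eq_or_ne i k with rfl | hi
    · exact hqk.left
    · obtain ⟨G, κ, q, -, -, hq⟩ := T.exists_isLobattoApprox_of_ne hi hk0 hk1 hp1 hrep
      exact hq.left
  have hright : ∀ i, T.interp βm βp α k p u i (T.rgt i) = u (T.rgt i) := fun i => by
    rcases eq_or_ne i k with rfl | hi
    · exact hqk.right
    · obtain ⟨G, κ, q, -, -, hq⟩ := T.exists_isLobattoApprox_of_ne hi hk0 hk1 hp1 hrep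
      exact hq.right
  have hsol : ∀ i, EqOn uh (T.interp βm βp α k p u i) (Icc (T.lft i) (T.rgt i)) := by
    obtain ⟨p', rfl⟩ : ∃ p', p = p' + 1 := ⟨p - 1, by omega⟩
    refine huh.eqOn T hm hβp (hGu.piecewiseDiff hwk) hf.zero_left hf.zero_right
      (fun v hv hva hvb => hrep.weak_form hm hβp haα hαb hf hv hva hvb) hleft hright
      (fun i hi => ?_) ?_ (fun i => ?_) (fun i => ?_) (fun i => ?_)
    · have e : T.interp βm βp α k (p' + 1) u i =
          ∑ n ∈ Finset.range (p' + 1 + 1), T.lobattoCoeff i u n • T.lobatto i n := by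
        ext x
        simp only [IFE.Mesh.interp, if_neg hi, Finset.sum_apply, Pi.smul_apply, smul_eq_mul]
      rw [e]
      exact Submodule.sum_mem _ fun n hn => Submodule.smul_mem _ _ (Submodule.subset_span
        ⟨n, Nat.lt_succ_iff.1 (Finset.mem_range.1 hn), rfl⟩)
    · have e : T.interp βm βp α k (p' + 1) u k = ∑ n ∈ Finset.range (p' + 1 + 1),
          T.genLobattoCoeff βm βp α k u n • T.genLobatto βm βp α k n := by
        ext x
        simp only [IFE.Mesh.interp, if_true, Finset.sum_apply, Pi.smul_apply, smul_eq_mul]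
      rw [e]
      exact Submodule.sum_mem _ fun n hn => Submodule.smul_mem _ _ (Submodule.subset_span
        ⟨n, Nat.lt_succ_iff.1 (Finset.mem_range.1 hn), rfl⟩)
    · rcases eq_or_ne i k with rfl | hi
      · exact hqk.isFlux.piecewiseDiff hwk
      · obtain ⟨G, κ, q, -, -, hq⟩ := T.exists_isLobattoApprox_of_ne hi hk0 hk1 hp1 hrep
        exact hq.isFlux.piecewiseDiff IFE.isWeight_one
    · rcases eq_or_ne i k with rfl | hi
      · exact hfluxk.piecewiseDiff hwk
      · obtain ⟨r, -, hr⟩ := (hfn i).exists_isFlux_of_eqOn (T.lft_lt_rgt i) hp1 (hcont i)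
          (huh.1.nonInterface i hi)
        exact hr.piecewiseDiff IFE.isWeight_one
    · rcases eq_or_ne i k with rfl | hi
      · exact hqk.integral_eq_zero (T.lft_lt_rgt i) hGk hfluxk hrk (κ := 1)
          fun x _ _ => mul_inv_cancel₀ (IFE.coeff_pos hm hβp x).ne'
      · obtain ⟨G, κ, q, hG, hκ, hq⟩ := T.exists_isLobattoApprox_of_ne hi hk0 hk1 hp1 hrep
        obtain ⟨r, hrd, hr⟩ := (hfn i).exists_isFlux_of_eqOn (T.lft_lt_rgt i) hp1 (hcont i)
          (huh.1.nonInterface i hi)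
        exact hq.integral_eq_zero (T.lft_lt_rgt i) hG hr hrd (κ := κ)
          fun x hx _ => by rw [mul_one, hκ x hx]
  have hsize : ∀ i n, (T.rgt i - T.lft i) ^ n ≤ T.size ^ n := fun i n =>
    pow_le_pow_left₀ (sub_pos.2 (T.lft_lt_rgt i)).le (T.length_le_size i) n
  have hsz' : ∀ n, 0 ≤ T.size ^ n := fun n =>
    pow_nonneg ((sub_pos.2 (T.lft_lt_rgt k)).le.trans (T.length_le_size k)) n
  have hs1 := IFE.stab_nonneg p 1
  have hmax : 0 < max βm βp := lt_max_of_lt_left hm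
  have hmin : 0 < min βm βp := lt_min hm hβp
  obtain ⟨ρ, hρ⟩ : ∃ ρ, ρ = max βm βp / min βm βp := ⟨_, rfl⟩
  have hρ0 : 0 ≤ ρ := by rw [hρ]; positivity
  have hsρ := IFE.stab_nonneg p ρ
  refine ⟨hsol, fun j => ?_, fun i hi => ?_, fun x hx hx0 => ?_, fun x hx hx0 => ?_⟩
  · induction j using Fin.cases with
    | zero => rw [T.node_zero, hf.zero_left, huh.1.memH10.2.2.1, sub_self]
    | succ i =>
      change u (T.rgt i) - uh (T.rgt i) = 0
      rw [hsol i (right_mem_Icc.2 (T.lft_lt_rgt i).le), hright, sub_self]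
  · obtain ⟨G, κ, q, hG, hκ, hq⟩ := T.exists_isLobattoApprox_of_ne hi hk0 hk1 hp1 hrep
    have hqh := hq.isFlux.congr (hsol i)
    refine ⟨fun x hx hx0 => ?_, fun x hx hx0 => ?_⟩
    · rw [hsol i hx]
      refine (hq.error x hx hx0).trans ?_
      calc (T.rgt i - T.lft i) * (IFE.stab p 1 * (M * (T.rgt i - T.lft i) ^ (p + 1)))
          = IFE.stab p 1 * M * (T.rgt i - T.lft i) ^ (p + 2) := by ring
        _ ≤ IFE.stab p 1 * M * T.size ^ (p + 2) :=
          mul_le_mul_of_nonneg_left (hsize i _) (mul_nonneg hs1 hM0)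
        _ = _ := by ring
    · have hev := (IFE.eval_comp_affine (IFE.legendre p) (x0 := T.lft i) (x1 := T.rgt i) x).trans hx0
      have hxI := ((hfn i).ortho p).mem_Ioo_of_eval_eq_zero IFE.isWeight_one (T.lft_lt_rgt i) hev
      have h1 := hG.hasDerivAt x hxI hxI.1.ne'
      have h2 := hqh.hasDerivAt x hxI hxI.1.ne'
      obtain ⟨c, hc⟩ := hq.flux_error
      have h3 := hc x hx
      rw [hev, mul_zero, sub_zero] at h3
      refine ⟨h1.differentiableAt, h2.differentiableAt, ?_⟩
      rw [h1.deriv, h2.deriv, one_mul, one_mul]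
      refine h3.trans ?_
      calc IFE.stab p 1 * (M * (T.rgt i - T.lft i) ^ (p + 1))
          = IFE.stab p 1 * M * (T.rgt i - T.lft i) ^ (p + 1) := by ring
        _ ≤ IFE.stab p 1 * M * T.size ^ (p + 1) :=
          mul_le_mul_of_nonneg_left (hsize i _) (mul_nonneg hs1 hM0)
        _ = _ := by ring
  · rw [hsol k hx]
    refine (hqk.error x hx hx0).trans ?_
    rw [← hρ]
    calc (min βm βp)⁻¹ * (T.rgt k - T.lft k) *
          (IFE.stab p ρ * (max βm βp * M * (T.rgt k - T.lft k) ^ (p + 1)))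
        = ρ * IFE.stab p ρ * M * (T.rgt k - T.lft k) ^ (p + 2) := by rw [hρ]; ring
      _ ≤ ρ * IFE.stab p ρ * M * T.size ^ (p + 2) :=
        mul_le_mul_of_nonneg_left (hsize k _) (mul_nonneg (mul_nonneg hρ0 hsρ) hM0)
      _ ≤ ρ * IFE.stab p ρ * M * T.size ^ (p + 2) + IFE.stab p ρ * M * T.size ^ (p + 2) :=
        le_add_of_nonneg_right (mul_nonneg (mul_nonneg hsρ hM0) (hsz' _))
      _ = _ := by ring
  · have hev := (IFE.eval_comp_affine (IFE.genLegendre βm βp (T.toRef k α) p)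
      (x0 := T.lft k) (x1 := T.rgt k) x).trans hx0
    have hxI := (hfk.ortho p).mem_Ioo_of_eval_eq_zero hwk (T.lft_lt_rgt k) hev
    obtain ⟨c, hc⟩ := hqk.flux_error
    have h3 := hc x hx
    rw [hev, mul_zero, sub_zero, ← hρ] at h3
    refine ⟨_, _, hGk.isFluxValue hm hβp hxI,
      (hqk.isFlux.congr (hsol k)).isFluxValue hm hβp hxI, h3.trans ?_⟩
    rw [← hρ]
    have hsM : 0 ≤ IFE.stab p ρ * max βm βp * M := mul_nonneg (mul_nonneg hsρ hmax.le) hM0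
    calc IFE.stab p ρ * (max βm βp * M * (T.rgt k - T.lft k) ^ (p + 1))
        = IFE.stab p ρ * max βm βp * M * (T.rgt k - T.lft k) ^ (p + 1) := by ring
      _ ≤ IFE.stab p ρ * max βm βp * M * T.size ^ (p + 1) :=
        mul_le_mul_of_nonneg_left (hsize k _) hsM
      _ ≤ IFE.stab p ρ * max βm βp * M * T.size ^ (p + 1) +
          ρ * (IFE.stab p ρ * max βm βp * M * T.size ^ (p + 1)) :=
        le_add_of_nonneg_right (mul_nonneg hρ0 (mul_nonneg hsM (hsz' _)))
      _ = _ := by ring
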